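/- Let $d\in\mathbb N$ and let $\omega:[0,\infty)\to[0,\infty)$ be a non-quasianalytic subadditive weight function, i.e. $\omega$ is continuous and increasing (in the weak sense) and satisfies: $(\alpha)$ $\omega(s+t)\le\omega(s)+\omega(t)$ for all $s,t\ge0$; $(\beta)$ $\int_1^\infty \omega(t)\,t^{-2}\,dt<\infty$; $(\gamma)$ $\log t=o(\omega(t))$ as $t\to\infty$; $(\delta)$ $t\mapsto\omega(e^t)$ is convex on $\mathbb R$. For a vector $x$ put $\omega(x):=\omega(|x|)$, with $|\cdot|$ the Euclidean norm. Let $\mathcal S_\omega(\mathbb R^d)$ be the space of all $f\in\mathcal S(\mathbb R^d)$ such that, for all $\lambda>0$ and all multi-indices $\alpha$, $$\sup_{x\in\mathbb R^d}e^{\lambda\omega(x)}|\partial^\alpha f(x)|<\infty,\qquad \sup_{\xi\in\mathbb R^d}e^{\lambda\omega(\xi)}|\partial^\alpha\widehat f(\xi)|<\infty,\qquad \widehat f(\xi)=\int_{\mathbb R^d}e^{-i\langle x,\xi\rangle}f(x)\,dx,$$ with the locally convex topology generated by these seminorms, and let $\mathcal S_\omega'(\mathbb R^d)$ be the space of continuous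 linear functionals $u:\mathcal S_\omega(\mathbb R^d)\to\mathbb C$. For $u\in\mathcal S'_\omega(\mathbb R^d)$, $\varphi\in\mathcal S_\omega(\mathbb R^d)$ write $\langle u,\varphi\rangle:=u(\overline\varphi)$. A function $f\in\mathcal S_\omega(\mathbb R^d)$ is identified with the functional $g\mapsto\int_{\mathbb R^d}f g\,dy$. For a window $\varphi\in\mathcal S_\omega(\mathbb R^d)\setminus\{0\}$ and $z=(x,\xi)\in\mathbb R^{2d}$ let $$V_\varphi u(z):=\langle u,\Pi(z)\varphi\rangle,\qquad \Pi(z)\varphi(y)=e^{i\langle y,\xi\rangle}\varphi(y-x).$$ Given $u\in\mathcal S'_\omega(\mathbb R^d)$ and a window $\varphi\in\mathcal S_\omega(\mathbb R^d)\setminus\{0\}$, the $\omega$-wave front set $\mathrm{WF}'_\omega(u)\subseteq\mathbb R^{2d}\setminus\{0\}$ is defined as follows: a point $z_0\in\mathbb R^{2d}\setminus\{0\}$ does not belong to $\mathrm{WF}'_\omega(u)$ if and only if there is an open conic set $\Gamma\subseteq\mathbb R^{2d}\setminus\{0\}$ (conic: $z\in\Gamma$ and $t>0$ imply $tz\in\Gamma$)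 with $z_0\in\Gamma$ and $$\sup_{z\in\Gamma}e^{\lambda\omega(z)}|V_\varphi u(z)|<\infty\qquad\text{for all }\lambda>0.$$ Then, for every $u\in\mathcal S'_\omega(\mathbb R^d)$, and whichever window $\varphi\in\mathcal S_\omega(\mathbb R^d)\setminus\{0\}$ is used in the definition of $\mathrm{WF}'_\omega(u)$, $$\mathrm{WF}'_\omega(u)=\emptyset\iff u\in\mathcal S_\omega(\mathbb R^d).$$ -/

import Mathlib

open scoped SchwartzMap FourierTransform RealInnerProductSpace

noncomputable section

namespace UltraGabor

/-- A non-quasianalytic subadditive weight function `ω : [0, ∞) → [0, ∞)`. The values of `toFun` at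
negative arguments play no role. -/
structure WeightFunction where
  toFun : ℝ → ℝ
  nonneg : ∀ t, 0 ≤ t → 0 ≤ toFun t
  continuousOn : ContinuousOn toFun (Set.Ici 0)
  monotoneOn : MonotoneOn toFun (Set.Ici 0)
  subadditive : ∀ s t, 0 ≤ s → 0 ≤ t → toFun (s + t) ≤ toFun s + toFun t
  nonquasianalytic : MeasureTheory.IntegrableOn (fun t => toFun t / t ^ 2) (Set.Ioi 1)
  log_isLittleO : Real.log =o[Filter.atTop] toFun
  convexOn_comp_exp : ConvexOn ℝ Set.univ (fun t => toFun (Real.exp t))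

/-- `ℝ^d` with the Euclidean norm. -/
abbrev Space (d : ℕ) : Type := EuclideanSpace ℝ (Fin d)

/-- Phase space `ℝ^{2d}`, with points `z = (x, ξ)`, `x = z.fst`, `ξ = z.snd`, and the Euclidean norm
`(|x|^2 + |ξ|^2)^{1/2}`. -/
abbrev PhaseSpace (d : ℕ) : Type := WithLp 2 (Space d × Space d)

variable {d : ℕ}

/-- The weight extended to a normed space by `ω(x) = ω(|x|)`. -/
def WeightFunction.at (ω : WeightFunction) {V : Type*} [Norm V] (x : V) : ℝ := ω.toFun ‖x‖

lemma WeightFunction.at_nonneg (ω : WeightFunction) (x : Space d) : 0 ≤ ω.at x :=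
  ω.nonneg _ (norm_nonneg _)

lemma WeightFunction.at_le_add (ω : WeightFunction) (x a : Space d) :
    ω.at x ≤ ω.at (x - a) + ω.at a := by
  refine le_trans ?_ (ω.subadditive _ _ (norm_nonneg (x - a)) (norm_nonneg a))
  refine ω.monotoneOn (norm_nonneg x) (add_nonneg (norm_nonneg _) (norm_nonneg _)) ?_
  simpa using norm_add_le (x - a) a

/-! ### Exponentially weighted bounds on all derivatives

The operator norm of the `n`-th derivative is comparable, up to constants depending only on `n` and
`d`, with the maximum of `|D^α f(x)|` over the multi-indices `α` with `|α| = n`. -/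

/-- For all `l > 0` and all `n`, the function `e^{l ω(x)} ‖f^{(n)}(x)‖` is bounded. -/
def WeightedBounds (ω : WeightFunction) (f : Space d → ℂ) : Prop :=
  ∀ l : ℝ, 0 < l → ∀ n : ℕ,
    BddAbove (Set.range fun x => Real.exp (l * ω.at x) * ‖iteratedFDeriv ℝ n f x‖)

/-- `sup_x e^{l ω(x)} ‖f^{(n)}(x)‖`. -/
def weightedSup (ω : WeightFunction) (l : ℝ) (n : ℕ) (f : Space d → ℂ) : ℝ :=
  ⨆ x, Real.exp (l * ω.at x) * ‖iteratedFDeriv ℝ n f x‖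

lemma weightedBounds_iff (ω : WeightFunction) (f : Space d → ℂ) :
    WeightedBounds ω f ↔ ∀ l : ℝ, 0 < l → ∀ n : ℕ, ∃ C : ℝ, ∀ x,
      Real.exp (l * ω.at x) * ‖iteratedFDeriv ℝ n f x‖ ≤ C := by
  simp only [WeightedBounds, BddAbove, Set.Nonempty, mem_upperBounds, Set.forall_mem_range]

/-! ### The Fourier transform `û(ξ) = ∫ e^{-i⟨x,ξ⟩} u(x) dx` -/

/-- The dilation `ξ ↦ ξ / (2π)`. -/
def dilation (d : ℕ) : Space d ≃L[ℝ] Space d :=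
  ContinuousLinearEquiv.smulLeft (Units.mk0 ((2 * Real.pi)⁻¹) (by positivity))

/-- The Fourier transform on Schwartz functions with the normalization
`û(ξ) = ∫ e^{-i⟨x,ξ⟩} u(x) dx`. -/
def angularFourier (d : ℕ) : 𝓢(Space d, ℂ) →L[ℂ] 𝓢(Space d, ℂ) :=
  (SchwartzMap.compCLMOfContinuousLinearEquiv ℂ (dilation d)).comp
    (SchwartzMap.fourierTransformCLM ℂ)

lemma angularFourier_apply (u : 𝓢(Space d, ℂ)) (ξ : Space d) :
    angularFourier d u ξ = ∫ x, Complex.exp (-(Complex.I * (⟪x, ξ⟫ : ℝ))) * u x := by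
  change 𝓕 (u : Space d → ℂ) ((2 * Real.pi)⁻¹ • ξ) = _
  rw [Real.fourier_eq']
  congr 1
  ext x
  rw [smul_eq_mul, real_inner_smul_right]
  congr 2
  have : (-2 * Real.pi * ((2 * Real.pi)⁻¹ * ⟪x, ξ⟫) : ℝ) = -⟪x, ξ⟫ := by
    field_simp
  rw [this]
  push_cast
  ring

/-! ### The space `S_ω(ℝ^d)` -/

/-- The Schwartz functions `u` such that `u` and `û` satisfy the weighted bounds. -/
def sOmegaSubmodule (ω : WeightFunction) (d : ℕ) : Submodule ℂ 𝓢(Space d, ℂ) where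
  carrier := {u | WeightedBounds ω u ∧ WeightedBounds ω (angularFourier d u)}
  zero_mem' := by
    have h : WeightedBounds ω (0 : Space d → ℂ) := by
      rw [weightedBounds_iff]
      intro l _ n
      refine ⟨0, fun x => ?_⟩
      simp
    refine ⟨h, ?_⟩
    rw [map_zero]
    exact h
  add_mem' := by
    have h : ∀ u v : 𝓢(Space d, ℂ), WeightedBounds ω u → WeightedBounds ω v →
        WeightedBounds ω (u + v : 𝓢(Space d, ℂ)) := by
      intro u v hu hv
      rw [weightedBounds_iff] at *
      intro l hl n
      obtain ⟨C, hC⟩ := hu l hl n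
      obtain ⟨D, hD⟩ := hv l hl n
      refine ⟨C + D, fun x => ?_⟩
      have e : iteratedFDeriv ℝ n (u + v : 𝓢(Space d, ℂ)) x
          = iteratedFDeriv ℝ n u x + iteratedFDeriv ℝ n v x :=
        iteratedFDeriv_add_apply (u.smooth n).contDiffAt (v.smooth n).contDiffAt
      rw [e]
      refine le_trans ?_ (add_le_add (hC x) (hD x))
      rw [← mul_add]
      exact mul_le_mul_of_nonneg_left (norm_add_le _ _) (Real.exp_nonneg _)
    rintro u v ⟨hu, hu'⟩ ⟨hv, hv'⟩
    refine ⟨h u v hu hv, ?_⟩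
    rw [map_add]
    exact h _ _ hu' hv'
  smul_mem' := by
    have h : ∀ (c : ℂ) (u : 𝓢(Space d, ℂ)), WeightedBounds ω u →
        WeightedBounds ω (c • u : 𝓢(Space d, ℂ)) := by
      intro c u hu
      rw [weightedBounds_iff] at *
      intro l hl n
      obtain ⟨C, hC⟩ := hu l hl n
      refine ⟨‖c‖ * C, fun x => ?_⟩
      have e : iteratedFDeriv ℝ n (c • u : 𝓢(Space d, ℂ)) x = c • iteratedFDeriv ℝ n u x :=
        iteratedFDeriv_const_smul_apply (u.smooth n).contDiffAt
      rw [e, norm_smul, mul_left_comm]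
      exact mul_le_mul_of_nonneg_left (hC x) (norm_nonneg c)
    rintro c u ⟨hu, hu'⟩
    refine ⟨h c u hu, ?_⟩
    rw [map_smul]
    exact h _ _ hu'

/-- The space `S_ω(ℝ^d)`. It is a separate type, so that it does not carry the topology induced
from the Schwartz space. -/
def SOmega (ω : WeightFunction) (d : ℕ) : Type := sOmegaSubmodule ω d

namespace SOmega

variable {ω : WeightFunction}

instance : AddCommGroup (SOmega ω d) := inferInstanceAs (AddCommGroup (sOmegaSubmodule ω d))

instance : Module ℂ (SOmega ω d) := inferInstanceAs (Module ℂ (sOmegaSubmodule ω d))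

/-- The inclusion of `S_ω(ℝ^d)` into the Schwartz space. -/
def toSchwartz : SOmega ω d →ₗ[ℂ] 𝓢(Space d, ℂ) := (sOmegaSubmodule ω d).subtype

instance : CoeFun (SOmega ω d) (fun _ => Space d → ℂ) := ⟨fun f => toSchwartz f⟩

lemma weightedBounds (f : SOmega ω d) : WeightedBounds ω (toSchwartz f) := f.2.1

lemma weightedBounds_fourier (f : SOmega ω d) : WeightedBounds ω (angularFourier d (toSchwartz f)) :=
  f.2.2

end SOmega

lemma weightedSup_add_le {ω : WeightFunction} {l : ℝ} (hl : 0 < l) (n : ℕ) (u v : 𝓢(Space d, ℂ))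
    (hu : WeightedBounds ω u) (hv : WeightedBounds ω v) :
    weightedSup ω l n (u + v : 𝓢(Space d, ℂ)) ≤ weightedSup ω l n u + weightedSup ω l n v := by
  refine ciSup_le fun x => ?_
  have e : iteratedFDeriv ℝ n (u + v : 𝓢(Space d, ℂ)) x
      = iteratedFDeriv ℝ n u x + iteratedFDeriv ℝ n v x :=
    iteratedFDeriv_add_apply (u.smooth n).contDiffAt (v.smooth n).contDiffAt
  rw [e]
  refine le_trans ?_ (add_le_add (le_ciSup (hu l hl n) x) (le_ciSup (hv l hl n) x))
  rw [← mul_add]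
  exact mul_le_mul_of_nonneg_left (norm_add_le _ _) (Real.exp_nonneg _)

lemma weightedSup_smul {ω : WeightFunction} (l : ℝ) (n : ℕ) (c : ℂ) (u : 𝓢(Space d, ℂ)) :
    weightedSup ω l n (c • u : 𝓢(Space d, ℂ)) = ‖c‖ * weightedSup ω l n u := by
  unfold weightedSup
  rw [Real.mul_iSup_of_nonneg (norm_nonneg c)]
  congr 1
  ext x
  have e : iteratedFDeriv ℝ n (c • u : 𝓢(Space d, ℂ)) x = c • iteratedFDeriv ℝ n u x :=
    iteratedFDeriv_const_smul_apply (u.smooth n).contDiffAt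
  rw [e, norm_smul, mul_left_comm]

/-- Indices of the seminorms of `S_ω`: a real `l > 0` and an order of differentiation `n`, with
`inl` for the seminorms of `u` and `inr` for those of `û`. -/
abbrev SeminormIndex : Type := ({l : ℝ // 0 < l} × ℕ) ⊕ ({l : ℝ // 0 < l} × ℕ)

instance : Nonempty SeminormIndex := ⟨Sum.inl (⟨1, one_pos⟩, 0)⟩

/-- The seminorms `sup_x e^{l ω(x)} ‖u^{(n)}(x)‖` and `sup_ξ e^{l ω(ξ)} ‖û^{(n)}(ξ)‖`. -/
def sOmegaSeminorms (ω : WeightFunction) (d : ℕ) : SeminormFamily ℂ (SOmega ω d) SeminormIndex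
  | Sum.inl (l, n) =>
      Seminorm.of (fun u => weightedSup ω l n (SOmega.toSchwartz u))
        (fun u v => by
          rw [map_add]
          exact weightedSup_add_le l.2 n _ _ u.weightedBounds v.weightedBounds)
        (fun c u => by
          rw [map_smul]
          exact weightedSup_smul _ n c _)
  | Sum.inr (l, n) =>
      Seminorm.of (fun u => weightedSup ω l n (angularFourier d (SOmega.toSchwartz u)))
        (fun u v => by
          rw [map_add, map_add]
          exact weightedSup_add_le l.2 n _ _ u.weightedBounds_fourier v.weightedBounds_fourier)
        (fun c u => by
          rw [map_smul, map_smul]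
          exact weightedSup_smul _ n c _)

/-- The locally convex topology of `S_ω(ℝ^d)`, generated by the seminorms above. -/
instance (ω : WeightFunction) (d : ℕ) : TopologicalSpace (SOmega ω d) :=
  (sOmegaSeminorms ω d).moduleFilterBasis.topology

lemma sOmega_withSeminorms (ω : WeightFunction) (d : ℕ) : WithSeminorms (sOmegaSeminorms ω d) :=
  ⟨rfl⟩

/-- The `ω`-tempered distributions: continuous linear functionals on `S_ω(ℝ^d)`. -/
abbrev SOmegaDual (ω : WeightFunction) (d : ℕ) : Type := SOmega ω d →L[ℂ] ℂ

/-! ### Conjugation and phase-space shifts on `S_ω(ℝ^d)` -/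

/-- The character `y ↦ e^{i⟨y,ξ⟩}`. -/
def character (ξ y : Space d) : ℂ := Complex.exp (Complex.I * (⟪y, ξ⟫ : ℝ))

lemma norm_character (ξ y : Space d) : ‖character ξ y‖ = 1 := by
  unfold character
  rw [mul_comm]
  exact Complex.norm_exp_ofReal_mul_I _

lemma contDiff_character (ξ : Space d) (n : ℕ∞) : ContDiff ℝ n (character ξ) := by
  unfold character
  have h : ContDiff ℝ n (fun y : Space d => ((⟪y, ξ⟫ : ℝ) : ℂ)) :=
    Complex.ofRealCLM.contDiff.comp (contDiff_id.inner ℝ contDiff_const)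
  exact (contDiff_const.mul h).cexp

lemma norm_iteratedFDeriv_character_le (ξ : Space d) (n : ℕ) (y : Space d) :
    ‖iteratedFDeriv ℝ n (character ξ) y‖ ≤ ‖ξ‖ ^ n := by
  set g : ℝ → ℂ := fun t => Complex.exp (Complex.I * (t : ℂ)) with hg
  have hgs : ContDiff ℝ n g := (contDiff_const.mul Complex.ofRealCLM.contDiff).cexp
  have hder : ∀ k : ℕ, iteratedDeriv k g = fun t => Complex.I ^ k * g t := by
    intro k
    induction k with
    | zero => ext t; simp
    | succ k ih =>
      rw [iteratedDeriv_succ, ih]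
      ext t
      have h1 : HasDerivAt g (g t * (Complex.I * 1)) t :=
        ((Complex.ofRealCLM.hasDerivAt (x := t)).const_mul Complex.I).cexp
      rw [(h1.const_mul (Complex.I ^ k)).deriv]
      ring
  have hfac : character ξ = g ∘ (innerSL ℝ ξ) := by
    ext z
    simp [character, hg, real_inner_comm]
  rw [hfac, (innerSL ℝ ξ).iteratedFDeriv_comp_right hgs y le_rfl]
  refine le_trans (ContinuousMultilinearMap.norm_compContinuousLinearMap_le _ _) ?_
  rw [norm_iteratedFDeriv_eq_norm_iteratedDeriv, hder]
  have h1 : ‖g (innerSL ℝ ξ y)‖ = 1 := by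
    change ‖Complex.exp _‖ = 1
    rw [mul_comm]
    exact Complex.norm_exp_ofReal_mul_I _
  change ‖Complex.I ^ n * g (innerSL ℝ ξ y)‖ * _ ≤ _
  rw [norm_mul, h1]
  simp

lemma hasTemperateGrowth_character (ξ : Space d) : (character ξ).HasTemperateGrowth :=
  ⟨contDiff_character ξ _, fun n =>
    ⟨0, ‖ξ‖ ^ n, fun y => by simpa using norm_iteratedFDeriv_character_le ξ n y⟩⟩

/-- Modulation `M_ξ f(y) = e^{i⟨y,ξ⟩} f(y)` on Schwartz functions. -/
def modulation (ξ : Space d) (f : 𝓢(Space d, ℂ)) : 𝓢(Space d, ℂ) :=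
  SchwartzMap.smulLeftCLM ℂ (character ξ) f

lemma modulation_apply (ξ : Space d) (f : 𝓢(Space d, ℂ)) (y : Space d) :
    modulation ξ f y = character ξ y * f y := by
  simp [modulation, SchwartzMap.smulLeftCLM_apply_apply (hasTemperateGrowth_character ξ)]

/-- Translation `T_x f(y) = f(y - x)` on Schwartz functions. -/
def translation (x : Space d) (f : 𝓢(Space d, ℂ)) : 𝓢(Space d, ℂ) :=
  SchwartzMap.compSubConstCLM ℂ x f

lemma translation_apply (x : Space d) (f : 𝓢(Space d, ℂ)) (y : Space d) :
    translation x f y = f (y - x) := rfl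

/-- Complex conjugation on Schwartz functions. -/
def conjugate (f : 𝓢(Space d, ℂ)) : 𝓢(Space d, ℂ) :=
  SchwartzMap.postcompCLM (𝕜 := ℝ) (Complex.conjCLE : ℂ →L[ℝ] ℂ) f

lemma conjugate_apply (f : 𝓢(Space d, ℂ)) (y : Space d) :
    conjugate f y = (starRingEnd ℂ) (f y) := rfl

/-- Reflection `f(-y)` on Schwartz functions. -/
def reflection (f : 𝓢(Space d, ℂ)) : 𝓢(Space d, ℂ) :=
  SchwartzMap.compCLMOfContinuousLinearEquiv ℂ (ContinuousLinearEquiv.neg ℝ) f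

lemma reflection_apply (f : 𝓢(Space d, ℂ)) (y : Space d) : reflection f y = f (-y) := rfl

section bounds

variable {ω : WeightFunction} {f : 𝓢(Space d, ℂ)}

lemma WeightedBounds.modulation (hf : WeightedBounds ω f) (ξ : Space d) :
    WeightedBounds ω (modulation ξ f) := by
  rw [weightedBounds_iff] at *
  intro l hl n
  choose C hC using fun k => hf l hl k
  refine ⟨∑ i ∈ Finset.range (n + 1), (n.choose i : ℝ) * ‖ξ‖ ^ i * C (n - i), fun x => ?_⟩
  have e : (UltraGabor.modulation ξ f : Space d → ℂ) = fun y => character ξ y * f y := by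
    ext y; exact modulation_apply ξ f y
  rw [e]
  have h := norm_iteratedFDeriv_mul_le (contDiff_character ξ n) (f.smooth n) x
    (le_refl ((n : ℕ∞) : WithTop ℕ∞))
  refine (mul_le_mul_of_nonneg_left h (Real.exp_nonneg _)).trans ?_
  rw [Finset.mul_sum]
  refine Finset.sum_le_sum fun i _ => ?_
  calc Real.exp (l * ω.at x) * ((n.choose i : ℝ) * ‖iteratedFDeriv ℝ i (character ξ) x‖ *
        ‖iteratedFDeriv ℝ (n - i) f x‖)
      = ((n.choose i : ℝ) * ‖iteratedFDeriv ℝ i (character ξ) x‖) *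
        (Real.exp (l * ω.at x) * ‖iteratedFDeriv ℝ (n - i) f x‖) := by ring
    _ ≤ ((n.choose i : ℝ) * ‖ξ‖ ^ i) * C (n - i) := by
        refine mul_le_mul ?_ (hC _ x) (by positivity) (by positivity)
        exact mul_le_mul_of_nonneg_left (norm_iteratedFDeriv_character_le ξ i x) (by positivity)

lemma WeightedBounds.translation (hf : WeightedBounds ω f) (a : Space d) :
    WeightedBounds ω (translation a f) := by
  rw [weightedBounds_iff] at *
  intro l hl n
  obtain ⟨C, hC⟩ := hf l hl n
  refine ⟨Real.exp (l * ω.at a) * C, fun x => ?_⟩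
  have e : (UltraGabor.translation a f : Space d → ℂ) = fun y => f (y - a) := rfl
  rw [e, iteratedFDeriv_comp_sub]
  calc Real.exp (l * ω.at x) * ‖iteratedFDeriv ℝ n f (x - a)‖
      ≤ Real.exp (l * ω.at a + l * ω.at (x - a)) * ‖iteratedFDeriv ℝ n f (x - a)‖ := by
        refine mul_le_mul_of_nonneg_right (Real.exp_le_exp.2 ?_) (norm_nonneg _)
        have := mul_le_mul_of_nonneg_left (ω.at_le_add x a) hl.le
        linarith
    _ = Real.exp (l * ω.at a) *
          (Real.exp (l * ω.at (x - a)) * ‖iteratedFDeriv ℝ n f (x - a)‖) := by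
        rw [Real.exp_add]; ring
    _ ≤ _ := mul_le_mul_of_nonneg_left (hC _) (Real.exp_nonneg _)

lemma WeightedBounds.conjugate (hf : WeightedBounds ω f) : WeightedBounds ω (conjugate f) := by
  rw [weightedBounds_iff] at *
  intro l hl n
  obtain ⟨C, hC⟩ := hf l hl n
  refine ⟨C, fun x => ?_⟩
  have e : (UltraGabor.conjugate f : Space d → ℂ) = Complex.conjLIE ∘ f := rfl
  rw [e, LinearIsometryEquiv.norm_iteratedFDeriv_comp_left]
  exact hC x

lemma WeightedBounds.reflection (hf : WeightedBounds ω f) : WeightedBounds ω (reflection f) := by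
  rw [weightedBounds_iff] at *
  intro l hl n
  obtain ⟨C, hC⟩ := hf l hl n
  refine ⟨C, fun x => ?_⟩
  have e : (UltraGabor.reflection f : Space d → ℂ)
      = f ∘ (LinearIsometryEquiv.neg ℝ : Space d ≃ₗᵢ[ℝ] Space d) := rfl
  rw [e, LinearIsometryEquiv.norm_iteratedFDeriv_comp_right]
  have h := hC (-x)
  simpa [WeightFunction.at] using h

end bounds

lemma angularFourier_modulation (ξ : Space d) (f : 𝓢(Space d, ℂ)) :
    angularFourier d (modulation ξ f) = translation ξ (angularFourier d f) := by
  ext η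
  rw [translation_apply, angularFourier_apply, angularFourier_apply]
  congr 1
  ext y
  rw [modulation_apply, character, ← mul_assoc, ← Complex.exp_add, inner_sub_right]
  congr 2
  push_cast
  ring

lemma angularFourier_translation (x : Space d) (f : 𝓢(Space d, ℂ)) :
    angularFourier d (translation x f) = modulation (-x) (angularFourier d f) := by
  ext η
  rw [modulation_apply, angularFourier_apply, angularFourier_apply,
    ← MeasureTheory.integral_const_mul, ← MeasureTheory.integral_add_right_eq_self _ x]
  congr 1
  ext y
  rw [translation_apply, add_sub_cancel_right, character, ← mul_assoc, ← Complex.exp_add,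
    inner_add_left, inner_neg_right, real_inner_comm]
  congr 2
  rw [real_inner_comm x η]
  push_cast
  ring

lemma angularFourier_conjugate (f : 𝓢(Space d, ℂ)) :
    angularFourier d (conjugate f) = conjugate (reflection (angularFourier d f)) := by
  ext η
  rw [conjugate_apply, reflection_apply, angularFourier_apply, angularFourier_apply,
    ← integral_conj]
  congr 1
  ext y
  rw [conjugate_apply, map_mul, ← Complex.exp_conj]
  simp

namespace SOmega

variable {ω : WeightFunction}

/-- The phase-space shift `Π(z) f = M_ξ T_x f`, that is `Π(z) f(y) = e^{i⟨y,ξ⟩} f(y - x)`, for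
`z = (x, ξ)`, on `S_ω(ℝ^d)`. -/
def phaseShift (z : PhaseSpace d) (f : SOmega ω d) : SOmega ω d :=
  ⟨modulation z.snd (translation z.fst (toSchwartz f)),
    (f.weightedBounds.translation _).modulation _, by
      rw [angularFourier_modulation, angularFourier_translation]
      exact (f.weightedBounds_fourier.modulation _).translation _⟩

lemma phaseShift_apply (z : PhaseSpace d) (f : SOmega ω d) (y : Space d) :
    phaseShift z f y = Complex.exp (Complex.I * (⟪y, z.snd⟫ : ℝ)) * f (y - z.fst) :=
  modulation_apply z.snd (translation z.fst (toSchwartz f)) y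

/-- Complex conjugation on `S_ω(ℝ^d)`. -/
def conj (f : SOmega ω d) : SOmega ω d :=
  ⟨conjugate (toSchwartz f), f.weightedBounds.conjugate, by
    rw [angularFourier_conjugate]
    exact f.weightedBounds_fourier.reflection.conjugate⟩

lemma conj_apply (f : SOmega ω d) (y : Space d) : conj f y = (starRingEnd ℂ) (f y) := rfl

end SOmega

/-! ### The short-time Fourier transform and the wave front set -/

variable {ω : WeightFunction}

/-- The conjugate linear action `⟨u, φ⟩ = u(φ̄)` of `S_ω'` on `S_ω`, consistent with the inner
product `⟨f, φ⟩ = ∫ f φ̄` of `L²`. -/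
def pairing (u : SOmegaDual ω d) (φ : SOmega ω d) : ℂ := u φ.conj

/-- The short-time Fourier transform `V_φ u(z) = ⟨u, Π(z) φ⟩` with window `φ`. -/
def stft (φ : SOmega ω d) (u : SOmegaDual ω d) (z : PhaseSpace d) : ℂ := pairing u (φ.phaseShift z)

/-- Subsets of phase space that are stable under multiplication by positive reals. -/
def IsConic (Γ : Set (PhaseSpace d)) : Prop := ∀ z ∈ Γ, ∀ t : ℝ, 0 < t → t • z ∈ Γ

/-- The `ω`-wave front set of `u`, defined with the window `φ`: a point `z₀ ≠ 0` is *not* in it if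
and only if there is an open conic set `Γ ⊆ ℝ^{2d} ∖ {0}` containing `z₀` such that
`sup_{z ∈ Γ} e^{l ω(z)} |V_φ u(z)| < ∞` for all `l > 0`. -/
def waveFrontSet (φ : SOmega ω d) (u : SOmegaDual ω d) : Set (PhaseSpace d) :=
  {z₀ | z₀ ≠ 0 ∧ ¬ ∃ Γ : Set (PhaseSpace d), IsOpen Γ ∧ IsConic Γ ∧ (0 : PhaseSpace d) ∉ Γ ∧
    z₀ ∈ Γ ∧ ∀ l : ℝ, 0 < l → BddAbove ((fun z => Real.exp (l * ω.at z) * ‖stft φ u z‖) '' Γ)}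

/-- The distribution `u` belongs to `S_ω(ℝ^d)`, where a function `f` in `S_ω(ℝ^d)` is identified
with the functional `g ↦ ∫ f g`. -/
def SOmegaDual.IsInSOmega (u : SOmegaDual ω d) : Prop :=
  ∃ f : SOmega ω d, ∀ g : SOmega ω d, u g = ∫ y, f y * g y

end UltraGabor

end

noncomputable section

namespace UltraGabor

open MeasureTheory

variable {d : ℕ} {ω : WeightFunction}

/-! ### Weights -/

/-! If `u` is given by `f` in `S_ω`, then `V_φ u(x,ξ)` is bounded by `∫ |f(y)| |φ(y - x)| dy`, which
decays in `x`. By Parseval it is also bounded by the analogous integral of the Fourier transforms,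
which decays in `ξ`. Together these give decay in all of phase space (`rapidDecay_analysis`), so the
complement of the origin serves as a single cone.

Conversely, an empty wave front set gives decay on a conic neighbourhood of every direction, hence
everywhere by compactness of the sphere (`bddAbove_stft_of_waveFrontSet_eq_empty`). The candidate
for `u` is then `κ⁻¹ ∫ u(Π(z)θ) conj(Π(z)θ) dz`, with `θ` the conjugate of `φ` and `κ = (2π)^d
‖θ‖²`. A superposition of atoms with rapidly decaying density lies in `S_ω`, since its Fourier
transform is again of this kind (`weightedBounds_synthesis`, `angularFourier_eq_synthesis`).

It remains to identify the candidate with `u`, that is, to prove `∫ V_θ g(z) u(Π(z)θ) dz = κ u(g)`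
without moving `u` under a vector-valued integral. Inversion bounds the seminorms of `g` by weighted
`L¹` norms of `V_θ g`. Cauchy-Schwarz and the Riesz theorem then give `u(g) = ∫ V_θ g · e^{lω} h`
with `h` in `L²` (`exists_representation`). Now Fubini and the scalar reproducing formula yield the
identity (`integral_analysis_mul_apply_shift`). -/

lemma WeightFunction.exists_one_add_pow_le (ω : WeightFunction) (r : ℕ) :
    ∃ C : ℝ, 0 < C ∧ ∀ t : ℝ, 0 ≤ t → (1 + t) ^ r ≤ C * Real.exp (ω.toFun t) := by
  -- This constant gives `(r + 1) log t ≤ ω(t)` for large `t`; the `+ 1` covers `r = 0`.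
  have h := ω.log_isLittleO.def (c := ((r : ℝ) + 1)⁻¹) (by positivity)
  obtain ⟨T, hT⟩ := Filter.eventually_atTop.1 h
  set M : ℝ := max T 1
  have hM : 1 ≤ M := le_max_right _ _
  -- The first summand handles `t ≤ M`, the second handles `t ≥ M ≥ 1`, where `1 + t ≤ 2t`.
  refine ⟨(1 + M) ^ r + 2 ^ r, by positivity, fun t ht => ?_⟩
  have h1 : 1 ≤ Real.exp (ω.toFun t) := Real.one_le_exp (ω.nonneg t ht)
  rw [add_mul]
  rcases le_total t M with htM | htM
  · have : (1 + t) ^ r ≤ (1 + M) ^ r := by gcongr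
    have h3 : (0 : ℝ) ≤ 2 ^ r * Real.exp (ω.toFun t) := by positivity
    have h4 : (1 + M) ^ r ≤ (1 + M) ^ r * Real.exp (ω.toFun t) :=
      le_mul_of_one_le_right (by positivity) h1
    linarith
  · have ht1 : 1 ≤ t := hM.trans htM
    have h2 := hT t ((le_max_left _ _).trans htM)
    rw [Real.norm_of_nonneg (Real.log_nonneg ht1), Real.norm_of_nonneg (ω.nonneg t ht)] at h2
    have h5 : (r : ℝ) * Real.log t ≤ ω.toFun t := by
      rw [inv_mul_eq_div, le_div_iff₀ (by positivity)] at h2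
      nlinarith [Real.log_nonneg ht1]
    have h6 : t ^ r ≤ Real.exp (ω.toFun t) := by
      rw [← Real.log_le_iff_le_exp (by positivity), Real.log_pow]
      exact h5
    have h7 : (1 + t) ^ r ≤ (2 * t) ^ r := by gcongr; linarith
    rw [mul_pow] at h7
    have h8 : (2 : ℝ) ^ r * t ^ r ≤ 2 ^ r * Real.exp (ω.toFun t) := by gcongr
    have h9 : (0 : ℝ) ≤ (1 + M) ^ r * Real.exp (ω.toFun t) := by positivity
    linarith

lemma WeightFunction.continuous_at (ω : WeightFunction) {V : Type*} [SeminormedAddCommGroup V] :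
    Continuous (fun x : V => ω.at x) :=
  ω.continuousOn.comp_continuous continuous_norm fun x => norm_nonneg x

lemma WeightFunction.at_neg (ω : WeightFunction) (x : Space d) : ω.at (-x) = ω.at x := by
  simp [WeightFunction.at]

lemma WeightFunction.integrable_exp_neg_at (ω : WeightFunction) (d : ℕ) :
    Integrable (fun x : Space d => Real.exp (-ω.at x)) := by
  obtain ⟨C, hC, h⟩ := ω.exists_one_add_pow_le (d + 1)
  have hi : Integrable (fun x : Space d => C * (1 + ‖x‖) ^ (-((d + 1 : ℕ) : ℝ))) :=
    (integrable_one_add_norm (by simp)).const_mul C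
  refine hi.mono' ω.continuous_at.neg.rexp.aestronglyMeasurable (.of_forall fun x => ?_)
  rw [Real.norm_of_nonneg (Real.exp_nonneg _), Real.exp_neg,
    Real.rpow_neg (by positivity), Real.rpow_natCast, ← div_eq_mul_inv,
    inv_le_comm₀ (Real.exp_pos _) (by positivity), inv_div, div_le_iff₀' hC]
  exact h _ (norm_nonneg x)

/-- The weight `ω(x) + ω(ξ)` on phase space. -/
def WeightFunction.pair (ω : WeightFunction) (z : Space d × Space d) : ℝ := ω.at z.1 + ω.at z.2

lemma WeightFunction.pair_nonneg (ω : WeightFunction) (z : Space d × Space d) : 0 ≤ ω.pair z :=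
  add_nonneg (ω.at_nonneg _) (ω.at_nonneg _)

lemma WeightFunction.continuous_pair (ω : WeightFunction) :
    Continuous (fun z : Space d × Space d => ω.pair z) :=
  (ω.continuous_at.comp continuous_fst).add (ω.continuous_at.comp continuous_snd)

lemma WeightFunction.pair_le_add (ω : WeightFunction) (z w : Space d × Space d) :
    ω.pair z ≤ ω.pair (z - w) + ω.pair w := by
  have h1 := ω.at_le_add z.1 w.1
  have h2 := ω.at_le_add z.2 w.2
  simp only [WeightFunction.pair, Prod.fst_sub, Prod.snd_sub]
  linarith

lemma WeightFunction.integrable_exp_neg_pair (ω : WeightFunction) (d : ℕ) :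
    Integrable (fun z : Space d × Space d => Real.exp (-ω.pair z)) := by
  have h := (ω.integrable_exp_neg_at d).mul_prod (ω.integrable_exp_neg_at d)
  refine h.congr (.of_forall fun z => ?_)
  simp only [WeightFunction.pair]
  rw [← Real.exp_add]
  ring_nf

/-- Follows from `|z| ≤ |x| + |ξ|` and subadditivity. With `pair_le_two_mul`, it makes decay for all
`l` the same for `ω(z)` and for `ω(x) + ω(ξ)`; the latter splits under product integrals. -/
lemma WeightFunction.at_toLp_le_pair (ω : WeightFunction) (z : Space d × Space d) :
    ω.at (WithLp.toLp 2 z) ≤ ω.pair z := by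
  refine le_trans ?_ (ω.subadditive _ _ (norm_nonneg z.1) (norm_nonneg z.2))
  refine ω.monotoneOn (norm_nonneg (WithLp.toLp 2 z)) (by simp; positivity) ?_
  rw [WithLp.prod_norm_eq_of_L2, Real.sqrt_le_left (by positivity)]
  change ‖z.1‖ ^ 2 + ‖z.2‖ ^ 2 ≤ _
  nlinarith [norm_nonneg z.1, norm_nonneg z.2]

lemma WeightFunction.pair_le_two_mul (ω : WeightFunction) (z : Space d × Space d) :
    ω.pair z ≤ 2 * ω.at (WithLp.toLp 2 z) := by
  have h1 : ω.at z.1 ≤ ω.at (WithLp.toLp 2 z) := by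
    refine ω.monotoneOn (norm_nonneg z.1) (norm_nonneg (WithLp.toLp 2 z)) ?_
    rw [WithLp.prod_norm_eq_of_L2]
    exact Real.le_sqrt_of_sq_le (by simp)
  have h2 : ω.at z.2 ≤ ω.at (WithLp.toLp 2 z) := by
    refine ω.monotoneOn (norm_nonneg z.2) (norm_nonneg (WithLp.toLp 2 z)) ?_
    rw [WithLp.prod_norm_eq_of_L2]
    exact Real.le_sqrt_of_sq_le (by simp)
  simp only [WeightFunction.pair]
  linarith

/-- Functions on phase space that decay faster than every `e^{-l (ω(x) + ω(ξ))}`. -/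
def RapidDecay (ω : WeightFunction) (H : Space d × Space d → ℂ) : Prop :=
  ∀ l : ℝ, 0 < l → ∃ C : ℝ, ∀ z, Real.exp (l * ω.pair z) * ‖H z‖ ≤ C

/-- One unit of decay beyond `|l|` is spent on the integrable function `e^{-ω(x)-ω(ξ)}`. -/
lemma RapidDecay.integrable_exp_mul {H : Space d × Space d → ℂ} (hH : RapidDecay ω H)
    (hm : AEStronglyMeasurable H) (l : ℝ) :
    Integrable (fun z => ‖H z‖ * Real.exp (l * ω.pair z)) := by
  obtain ⟨C, hC⟩ := hH (|l| + 1) (by positivity)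
  refine ((ω.integrable_exp_neg_pair d).const_mul C).mono'
    (hm.norm.mul (continuous_const.mul ω.continuous_pair).rexp.aestronglyMeasurable)
    (.of_forall fun z => ?_)
  rw [Real.norm_of_nonneg (by positivity)]
  have h1 : Real.exp (l * ω.pair z) ≤ Real.exp ((|l| + 1) * ω.pair z) * Real.exp (-ω.pair z) := by
    rw [← Real.exp_add, Real.exp_le_exp]
    have := mul_le_mul_of_nonneg_right (le_abs_self l) (ω.pair_nonneg z)
    linarith
  calc ‖H z‖ * Real.exp (l * ω.pair z)
      ≤ ‖H z‖ * (Real.exp ((|l| + 1) * ω.pair z) * Real.exp (-ω.pair z)) := by gcongr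
    _ = (Real.exp ((|l| + 1) * ω.pair z) * ‖H z‖) * Real.exp (-ω.pair z) := by ring
    _ ≤ _ := mul_le_mul_of_nonneg_right (hC z) (Real.exp_nonneg _)

lemma RapidDecay.integrable {H : Space d × Space d → ℂ} (hH : RapidDecay ω H)
    (hm : AEStronglyMeasurable H) : Integrable H := by
  have := hH.integrable_exp_mul hm 0
  simp only [zero_mul, Real.exp_zero, mul_one] at this
  exact (integrable_norm_iff hm).1 this

/-! ### Time-frequency atoms -/

/-- The time-frequency shift `e^{i⟨y,ξ⟩} θ(y - x)` of `θ` by `z = (x, ξ)`. -/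
def atom (θ : 𝓢(Space d, ℂ)) (z : Space d × Space d) : 𝓢(Space d, ℂ) :=
  modulation z.2 (translation z.1 θ)

lemma atom_apply (θ : 𝓢(Space d, ℂ)) (z : Space d × Space d) (y : Space d) :
    atom θ z y = character z.2 y * θ (y - z.1) := by
  rw [atom, modulation_apply, translation_apply]

lemma norm_atom_apply (θ : 𝓢(Space d, ℂ)) (z : Space d × Space d) (y : Space d) :
    ‖atom θ z y‖ = ‖θ (y - z.1)‖ := by
  rw [atom_apply, norm_mul, norm_character, one_mul]

lemma contDiff_atom (θ : 𝓢(Space d, ℂ)) (n : ℕ∞) :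
    ContDiff ℝ n (fun p : (Space d × Space d) × Space d => atom θ p.1 p.2) := by
  simp only [atom_apply, character]
  have h : ContDiff ℝ n (fun p : (Space d × Space d) × Space d => ((⟪p.2, p.1.2⟫ : ℝ) : ℂ)) :=
    Complex.ofRealCLM.contDiff.comp (contDiff_snd.inner ℝ (contDiff_snd.comp contDiff_fst))
  exact (contDiff_const.mul h).cexp.mul
    ((θ.smooth n).comp (contDiff_snd.sub (contDiff_fst.comp contDiff_fst)))

lemma continuous_atom (θ : 𝓢(Space d, ℂ)) :
    Continuous (fun p : (Space d × Space d) × Space d => atom θ p.1 p.2) :=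
  (contDiff_atom θ 0).continuous

/-- The derivative in `y` alone is the full derivative of the jointly smooth function `G`,
restricted to the fibre directions. This supplies measurability in `z` for differentiation under the
integral. -/
lemma continuous_iteratedFDeriv_atom (θ : 𝓢(Space d, ℂ)) (n : ℕ) :
    Continuous (fun p : (Space d × Space d) × Space d => iteratedFDeriv ℝ n (atom θ p.1) p.2) := by
  set G : (Space d × Space d) × Space d → ℂ := fun p => atom θ p.1 p.2 with hG
  have key : ∀ p : (Space d × Space d) × Space d, iteratedFDeriv ℝ n (atom θ p.1) p.2
      = ContinuousMultilinearMap.compContinuousLinearMapL (𝕜 := ℝ) (F := ℂ)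
        (fun _ : Fin n => ContinuousLinearMap.inr ℝ (Space d × Space d) (Space d))
        (iteratedFDeriv ℝ n G p) := by
    intro p
    have e : (atom θ p.1 : Space d → ℂ)
        = (fun q => G ((p.1, 0) + q)) ∘ ContinuousLinearMap.inr ℝ (Space d × Space d) (Space d) := by
      ext y
      simp [hG]
    have hs : ContDiff ℝ n (fun q => G ((p.1, 0) + q)) :=
      (contDiff_atom θ n).comp (contDiff_const.add contDiff_id)
    rw [e, ContinuousLinearMap.iteratedFDeriv_comp_right _ hs _ le_rfl, iteratedFDeriv_comp_add_left]
    simp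
  simp only [key]
  exact (ContinuousLinearMap.continuous _).comp
    ((contDiff_atom θ n).continuous_iteratedFDeriv (le_refl ((n : ℕ∞) : WithTop ℕ∞)))

/-- By Leibniz, derivatives of the character cost powers of `|ξ|`, absorbed by `e^{ω(ξ)}`. The
weight at `y` splits by subadditivity into weights at `x` and at `y - x`. Hence `L = l + 1`. -/
lemma exists_iteratedFDeriv_atom_le {θ : 𝓢(Space d, ℂ)} (hθ : WeightedBounds ω θ) (l : ℝ)
    (hl : 0 < l) (n : ℕ) : ∃ C L : ℝ, 0 ≤ C ∧ 0 < L ∧ ∀ (z : Space d × Space d) (y : Space d),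
      Real.exp (l * ω.at y) * ‖iteratedFDeriv ℝ n (atom θ z) y‖
        ≤ C * Real.exp (L * ω.pair z) := by
  rw [weightedBounds_iff] at hθ
  choose C hC using fun k => hθ l hl k
  obtain ⟨D, hD, hD'⟩ := ω.exists_one_add_pow_le n
  have hC0 : ∀ k, 0 ≤ C k := fun k => le_trans (by positivity) (hC k 0)
  refine ⟨(∑ i ∈ Finset.range (n + 1), (n.choose i : ℝ) * C (n - i)) * D, l + 1,
    mul_nonneg (Finset.sum_nonneg fun i _ => mul_nonneg (by positivity) (hC0 _)) hD.le,
    by positivity, fun z y => ?_⟩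
  have e : (atom θ z : Space d → ℂ) = fun y => character z.2 y * θ (y - z.1) := by
    ext y; exact atom_apply θ z y
  have h := norm_iteratedFDeriv_mul_le (contDiff_character z.2 n)
    ((θ.smooth n).comp (contDiff_id.sub contDiff_const) : ContDiff ℝ n fun y => θ (y - z.1)) y
    (le_refl ((n : ℕ∞) : WithTop ℕ∞))
  rw [e]
  refine (mul_le_mul_of_nonneg_left h (Real.exp_nonneg _)).trans ?_
  have hw : Real.exp (l * ω.at y) ≤ Real.exp (l * ω.at z.1) * Real.exp (l * ω.at (y - z.1)) := by
    rw [← Real.exp_add, Real.exp_le_exp]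
    have := mul_le_mul_of_nonneg_left (ω.at_le_add y z.1) hl.le
    linarith
  have hfin : Real.exp (l * ω.at z.1) * Real.exp (ω.at z.2) ≤ Real.exp ((l + 1) * ω.pair z) := by
    rw [← Real.exp_add, Real.exp_le_exp, WeightFunction.pair]
    nlinarith [ω.at_nonneg z.1, mul_nonneg hl.le (ω.at_nonneg z.2)]
  have hterm : ∀ i ∈ Finset.range (n + 1), Real.exp (l * ω.at y) *
      ((n.choose i : ℝ) * ‖iteratedFDeriv ℝ i (character z.2) y‖ *
        ‖iteratedFDeriv ℝ (n - i) (fun y => θ (y - z.1)) y‖)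
      ≤ (n.choose i : ℝ) * C (n - i) * (D * Real.exp ((l + 1) * ω.pair z)) := by
    intro i hi
    have hi' : i ≤ n := Nat.lt_succ_iff.1 (Finset.mem_range.1 hi)
    rw [iteratedFDeriv_comp_sub]
    have h1 : ‖iteratedFDeriv ℝ i (character z.2) y‖ ≤ D * Real.exp (ω.at z.2) := by
      refine (norm_iteratedFDeriv_character_le z.2 i y).trans ?_
      refine le_trans ?_ (hD' _ (norm_nonneg z.2))
      calc ‖z.2‖ ^ i ≤ (1 + ‖z.2‖) ^ i := by gcongr; linarith
        _ ≤ _ := pow_le_pow_right₀ (by linarith [norm_nonneg z.2]) hi'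
    calc _ ≤ Real.exp (l * ω.at z.1) * Real.exp (l * ω.at (y - z.1)) *
          ((n.choose i : ℝ) * (D * Real.exp (ω.at z.2)) *
            ‖iteratedFDeriv ℝ (n - i) θ (y - z.1)‖) := by gcongr
      _ = (n.choose i : ℝ) * (Real.exp (l * ω.at (y - z.1)) *
            ‖iteratedFDeriv ℝ (n - i) θ (y - z.1)‖) *
          (D * (Real.exp (l * ω.at z.1) * Real.exp (ω.at z.2))) := by ring
      _ ≤ _ := by
        gcongr
        · exact mul_nonneg (by positivity) (hC0 _)
        · exact hC _ _
  rw [Finset.mul_sum]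
  refine (Finset.sum_le_sum hterm).trans (le_of_eq ?_)
  rw [← Finset.sum_mul, mul_assoc]

/-! ### Smoothness of parametric integrals -/

/-- Since the bounds `b n` are uniform in `y`, dominated differentiation applies at every order and
the Taylor series may be integrated term by term. -/
lemma hasFTaylorSeriesUpTo_integral {α E F : Type*} [MeasurableSpace α] {μ : Measure α}
    [NormedAddCommGroup E] [NormedSpace ℝ E] [NormedAddCommGroup F] [NormedSpace ℝ F]
    [CompleteSpace F] {f : α → E → F} (hf : ∀ a, ContDiff ℝ (⊤ : ℕ∞) (f a))
    (hm : ∀ n y, AEStronglyMeasurable (fun a => iteratedFDeriv ℝ n (f a) y) μ)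
    {b : ℕ → α → ℝ} (hb : ∀ n, Integrable (b n) μ)
    (hfb : ∀ n a y, ‖iteratedFDeriv ℝ n (f a) y‖ ≤ b n a) :
    HasFTaylorSeriesUpTo (⊤ : ℕ∞) (fun y => ∫ a, f a y ∂μ)
      (fun y n => ∫ a, iteratedFDeriv ℝ n (f a) y ∂μ) := by
  have hint : ∀ n y, Integrable (fun a => iteratedFDeriv ℝ n (f a) y) μ := fun n y =>
    (hb n).mono' (hm n y) (.of_forall fun a => hfb n a y)
  refine (hasFTaylorSeriesUpTo_top_iff' le_rfl).2 ⟨fun y => ?_, fun n y => ?_⟩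
  · have h := ((continuousMultilinearCurryFin0 ℝ E F).toContinuousLinearEquiv.toContinuousLinearMap
      ).integral_comp_comm (hint 0 y)
    exact h.symm
  · let Λ : (E [×(n + 1)]→L[ℝ] F) →L[ℝ] (E →L[ℝ] (E [×n]→L[ℝ] F)) :=
      (continuousMultilinearCurryLeftEquiv ℝ (fun _ : Fin (n + 1) => E) F
      ).toContinuousLinearEquiv.toContinuousLinearMap
    have h : ∫ a, Λ (iteratedFDeriv ℝ (n + 1) (f a) y) ∂μ
        = Λ (∫ a, iteratedFDeriv ℝ (n + 1) (f a) y ∂μ) :=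
      ContinuousLinearMap.integral_comp_comm (𝕜 := ℝ) (Fₗ := E →L[ℝ] (E [×n]→L[ℝ] F)) Λ
        (hint (n + 1) y)
    have h2 : HasFDerivAt (fun y => ∫ a, iteratedFDeriv ℝ n (f a) y ∂μ)
        (∫ a, Λ (iteratedFDeriv ℝ (n + 1) (f a) y) ∂μ) y := by
      refine hasFDerivAt_integral_of_dominated_of_fderiv_le (bound := b (n + 1))
        (F' := fun y a => Λ (iteratedFDeriv ℝ (n + 1) (f a) y)) Filter.univ_mem
        (.of_forall fun y => hm n y) (hint n y) (Λ.continuous.comp_aestronglyMeasurable (hm _ y))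
        (.of_forall fun a y' _ => ?_) (hb _) (.of_forall fun a y' _ => ?_)
      · exact (LinearIsometryEquiv.norm_map _ _).trans_le (hfb _ a y')
      · have hd : DifferentiableAt ℝ (iteratedFDeriv ℝ n (f a)) y' :=
          ((hf a).differentiable_iteratedFDeriv (by exact_mod_cast WithTop.coe_lt_top n)) y'
        have := hd.hasFDerivAt
        rw [fderiv_iteratedFDeriv] at this
        exact this
    rw [h] at h2
    exact h2

/-! ### Superpositions of time-frequency atoms -/

/-- The superposition `∫ H(z) Π(σ z) θ dz` of time-frequency shifts of `θ`. -/
def synthesis (θ : 𝓢(Space d, ℂ)) (σ : Space d × Space d → Space d × Space d)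
    (H : Space d × Space d → ℂ) (y : Space d) : ℂ := ∫ z, H z * atom θ (σ z) y

section synthesis

variable {θ : 𝓢(Space d, ℂ)} {σ : Space d × Space d → Space d × Space d}
  {H : Space d × Space d → ℂ}

lemma iteratedFDeriv_const_mul_atom (c : ℂ) (z : Space d × Space d) (n : ℕ) (y : Space d) :
    iteratedFDeriv ℝ n (fun y => c * atom θ z y) y = c • iteratedFDeriv ℝ n (atom θ z) y :=
  iteratedFDeriv_const_smul_apply (a := c) (f := (atom θ z : Space d → ℂ))
    ((atom θ z).smooth n).contDiffAt

/-- The weight-preserving map `σ` allows one argument for three cases: the identity for inversion,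
`(x,ξ) ↦ (ξ,-x)` for Fourier transforms, and `(x,ξ) ↦ (x,-ξ)` for conjugate atoms. -/
lemma hasFTaylorSeriesUpTo_synthesis (hθ : WeightedBounds ω θ) (hσ : Continuous σ)
    (hσω : ∀ z, ω.pair (σ z) = ω.pair z) (hm : AEStronglyMeasurable H) (hH : RapidDecay ω H) :
    HasFTaylorSeriesUpTo (⊤ : ℕ∞) (synthesis θ σ H)
      (fun y n => ∫ z, H z • iteratedFDeriv ℝ n (atom θ (σ z)) y) := by
  choose C L hC hL h using exists_iteratedFDeriv_atom_le hθ 1 one_pos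
  have := hasFTaylorSeriesUpTo_integral (μ := volume) (f := fun z y => H z * atom θ (σ z) y)
    (b := fun n z => C n * (‖H z‖ * Real.exp (L n * ω.pair z)))
    (fun z => contDiff_const.mul ((atom θ (σ z)).smooth _)) (fun n y => ?_)
    (fun n => (hH.integrable_exp_mul hm (L n)).const_mul (C n)) (fun n z y => ?_)
  · simp only [iteratedFDeriv_const_mul_atom] at this
    exact this
  · simp only [iteratedFDeriv_const_mul_atom]
    exact hm.smul ((continuous_iteratedFDeriv_atom θ n).comp
      (hσ.prodMk continuous_const)).aestronglyMeasurable
  · rw [iteratedFDeriv_const_mul_atom, norm_smul]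
    have h1 := h n (σ z) y
    rw [hσω] at h1
    have h2 : ‖iteratedFDeriv ℝ n (atom θ (σ z)) y‖ ≤ C n * Real.exp (L n * ω.pair z) := by
      refine le_trans (le_mul_of_one_le_left (norm_nonneg _) ?_) h1
      exact Real.one_le_exp (mul_nonneg zero_le_one (ω.at_nonneg y))
    calc _ ≤ ‖H z‖ * (C n * Real.exp (L n * ω.pair z)) := by gcongr
      _ = _ := by ring

lemma contDiff_synthesis (hθ : WeightedBounds ω θ) (hσ : Continuous σ)
    (hσω : ∀ z, ω.pair (σ z) = ω.pair z) (hm : AEStronglyMeasurable H) (hH : RapidDecay ω H) :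
    ContDiff ℝ (⊤ : ℕ∞) (synthesis θ σ H) :=
  (hasFTaylorSeriesUpTo_synthesis hθ hσ hσω hm hH).contDiff

/-- The constants do not depend on the density `H`. -/
lemma exists_iteratedFDeriv_synthesis_le (hθ : WeightedBounds ω θ) (hσ : Continuous σ)
    (hσω : ∀ z, ω.pair (σ z) = ω.pair z) (l : ℝ) (hl : 0 < l) (n : ℕ) :
    ∃ C L : ℝ, 0 ≤ C ∧ 0 < L ∧ ∀ H : Space d × Space d → ℂ, AEStronglyMeasurable H →
      RapidDecay ω H → ∀ y, Real.exp (l * ω.at y) * ‖iteratedFDeriv ℝ n (synthesis θ σ H) y‖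
        ≤ C * ∫ z, ‖H z‖ * Real.exp (L * ω.pair z) := by
  obtain ⟨C, L, hC, hL, h⟩ := exists_iteratedFDeriv_atom_le hθ l hl n
  refine ⟨C, L, hC, hL, fun H hm hH y => ?_⟩
  rw [← (hasFTaylorSeriesUpTo_synthesis hθ hσ hσω hm hH).eq_iteratedFDeriv
    (by exact_mod_cast le_top)]
  have h1 : ‖∫ z, H z • iteratedFDeriv ℝ n (atom θ (σ z)) y‖ ≤
      ∫ z, Real.exp (-(l * ω.at y)) * (C * (‖H z‖ * Real.exp (L * ω.pair z))) := by
    refine norm_integral_le_of_norm_le (((hH.integrable_exp_mul hm L).const_mul C).const_mul _)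
      (.of_forall fun z => ?_)
    have h2 := h (σ z) y
    rw [hσω] at h2
    rw [norm_smul, Real.exp_neg, ← div_eq_inv_mul, le_div_iff₀' (Real.exp_pos _)]
    calc _ = ‖H z‖ * (Real.exp (l * ω.at y) * ‖iteratedFDeriv ℝ n (atom θ (σ z)) y‖) := by ring
      _ ≤ ‖H z‖ * (C * Real.exp (L * ω.pair z)) := by gcongr
      _ = _ := by ring
  rw [integral_const_mul, integral_const_mul, Real.exp_neg, ← div_eq_inv_mul,
    le_div_iff₀' (Real.exp_pos _)] at h1
  exact h1

lemma weightedBounds_synthesis (hθ : WeightedBounds ω θ) (hσ : Continuous σ)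
    (hσω : ∀ z, ω.pair (σ z) = ω.pair z) (hm : AEStronglyMeasurable H) (hH : RapidDecay ω H) :
    WeightedBounds ω (synthesis θ σ H) := by
  rw [weightedBounds_iff]
  intro l hl n
  obtain ⟨C, L, -, -, h⟩ := exists_iteratedFDeriv_synthesis_le hθ hσ hσω l hl n
  exact ⟨_, h H hm hH⟩

/-- A smooth function with exponentially weighted bounds is a Schwartz function. -/
def WeightedBounds.toSchwartzMap {f : Space d → ℂ} (hf : WeightedBounds ω f)
    (hs : ContDiff ℝ (⊤ : ℕ∞) f) : 𝓢(Space d, ℂ) where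
  toFun := f
  smooth' := hs
  decay' k n := by
    obtain ⟨C, hC⟩ := (weightedBounds_iff ω f).1 hf 1 one_pos n
    obtain ⟨D, hD, hD'⟩ := ω.exists_one_add_pow_le k
    refine ⟨D * C, fun x => ?_⟩
    have h1 : ‖x‖ ^ k ≤ D * Real.exp (1 * ω.at x) := by
      rw [one_mul]
      refine le_trans ?_ (hD' _ (norm_nonneg x))
      gcongr
      linarith
    calc _ ≤ D * Real.exp (1 * ω.at x) * ‖iteratedFDeriv ℝ n f x‖ := by gcongr
      _ = D * (Real.exp (1 * ω.at x) * ‖iteratedFDeriv ℝ n f x‖) := by ring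
      _ ≤ _ := by gcongr; exact hC x

/-- The Fourier transform turns phase space by a quarter turn; the unimodular phase comes from
commuting a translation with a modulation. -/
lemma angularFourier_atom (θ : 𝓢(Space d, ℂ)) (z : Space d × Space d) (η : Space d) :
    angularFourier d (atom θ z) η
      = character z.1 z.2 * atom (angularFourier d θ) (z.2, -z.1) η := by
  rw [atom, angularFourier_modulation, angularFourier_translation, translation_apply,
    modulation_apply, atom_apply, ← mul_assoc]
  congr 1
  rw [character, character, character, ← Complex.exp_add, inner_sub_left]
  simp only [inner_neg_right]
  congr 1
  push_cast
  ring

lemma integrable_mul_atom (hm : AEStronglyMeasurable H) (hH : RapidDecay ω H) (hσ : Continuous σ)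
    (θ : 𝓢(Space d, ℂ)) (y : Space d) : Integrable (fun z => H z * atom θ (σ z) y) := by
  obtain ⟨C, -, hC⟩ := θ.decay 0 0
  refine ((hH.integrable hm).norm.mul_const C).mono' (hm.mul ((continuous_atom θ).comp
    (hσ.prodMk continuous_const)).aestronglyMeasurable) (.of_forall fun z => ?_)
  rw [norm_mul, norm_atom_apply]
  gcongr
  simpa using hC (y - (σ z).1)

lemma integrable_prod_mul_atom (hm : AEStronglyMeasurable H) (hH : RapidDecay ω H)
    (hσ : Continuous σ) (θ : 𝓢(Space d, ℂ)) {k : Space d → ℂ} (hk : Continuous k)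
    {M : ℝ} (hkM : ∀ y, ‖k y‖ ≤ M) :
    Integrable (fun p : (Space d × Space d) × Space d => H p.1 * atom θ (σ p.1) p.2 * k p.2)
      (volume.prod volume) := by
  have hmeas : AEStronglyMeasurable
      (fun p : (Space d × Space d) × Space d => H p.1 * atom θ (σ p.1) p.2 * k p.2)
      (volume.prod volume) :=
    (hm.comp_fst.mul ((continuous_atom θ).comp ((hσ.comp continuous_fst).prodMk
      continuous_snd)).aestronglyMeasurable).mul (hk.comp continuous_snd).aestronglyMeasurable
  have hM : 0 ≤ M := (norm_nonneg _).trans (hkM 0)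
  rw [integrable_prod_iff hmeas]
  have hθi : ∀ x : Space d, Integrable (fun y => ‖θ (y - x)‖) := fun x =>
    (θ.integrable.norm).comp_sub_right x
  have hb : ∀ z y, ‖H z * atom θ (σ z) y * k y‖ ≤ ‖H z‖ * M * ‖θ (y - (σ z).1)‖ := by
    intro z y
    rw [norm_mul, norm_mul, norm_atom_apply]
    calc _ ≤ ‖H z‖ * ‖θ (y - (σ z).1)‖ * M := by gcongr; exact hkM y
      _ = _ := by ring
  have hc : ∀ z, Continuous (fun y => H z * atom θ (σ z) y * k y) := fun z =>
    (continuous_const.mul (atom θ (σ z)).continuous).mul hk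
  have hi : ∀ z, Integrable (fun y => H z * atom θ (σ z) y * k y) := fun z =>
    ((hθi (σ z).1).const_mul _).mono' (hc z).aestronglyMeasurable (.of_forall (hb z))
  refine ⟨.of_forall hi, ?_⟩
  refine ((hH.integrable hm).norm.mul_const (M * ∫ y, ‖θ y‖)).mono'
    hmeas.norm.integral_prod_right' (.of_forall fun z => ?_)
  rw [Real.norm_of_nonneg (integral_nonneg fun y => norm_nonneg _)]
  refine (integral_mono (hi z).norm ((hθi (σ z).1).const_mul _) (hb z)).trans (le_of_eq ?_)
  rw [integral_const_mul, integral_sub_right_eq_self (fun y => ‖θ y‖) (σ z).1, mul_assoc]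

/-- Fubini. It is applied with `k` an exponential, a conjugate atom and a test function. -/
lemma integral_synthesis_mul (hm : AEStronglyMeasurable H) (hH : RapidDecay ω H)
    (hσ : Continuous σ) (θ : 𝓢(Space d, ℂ)) {k : Space d → ℂ} (hk : Continuous k)
    {M : ℝ} (hkM : ∀ y, ‖k y‖ ≤ M) :
    ∫ y, synthesis θ σ H y * k y = ∫ z, H z * ∫ y, atom θ (σ z) y * k y := by
  have h := integral_integral_swap (f := fun z y => H z * atom θ (σ z) y * k y)
    (integrable_prod_mul_atom hm hH hσ θ hk hkM)
  simp only [synthesis, ← integral_mul_const, ← integral_const_mul]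
  rw [← h]
  simp only [mul_assoc]

/-- The Fourier transform of a superposition of atoms is a superposition of atoms. -/
lemma angularFourier_eq_synthesis (hm : AEStronglyMeasurable H) (hH : RapidDecay ω H)
    (hσ : Continuous σ) {f : 𝓢(Space d, ℂ)} (hf : ∀ y, f y = synthesis θ σ H y) :
    (angularFourier d f : Space d → ℂ) = synthesis (angularFourier d θ)
      (fun z => ((σ z).2, -(σ z).1)) (fun z => H z * character (σ z).1 (σ z).2) := by
  ext η
  rw [angularFourier_apply]
  have hc : Continuous (fun y : Space d => Complex.exp (-(Complex.I * (⟪y, η⟫ : ℝ)))) :=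
    (continuous_const.mul (Complex.continuous_ofReal.comp
      (continuous_id.inner continuous_const))).neg.cexp
  have hn : ∀ y : Space d, ‖Complex.exp (-(Complex.I * (⟪y, η⟫ : ℝ)))‖ ≤ 1 := by
    intro y
    have := norm_character (-η) y
    rw [character, inner_neg_right] at this
    refine le_of_eq (Eq.trans ?_ this)
    congr 2
    push_cast
    ring
  have h := integral_synthesis_mul hm hH hσ θ hc hn
  simp only [hf]
  simp only [mul_comm (Complex.exp _)]
  rw [h, synthesis]
  congr 1
  ext z
  rw [mul_assoc, ← angularFourier_atom, angularFourier_apply]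
  simp only [mul_comm (Complex.exp _)]

lemma continuous_character_comp (hσ : Continuous σ) :
    Continuous (fun z => character (σ z).1 (σ z).2) := by
  simp only [character]
  exact (continuous_const.mul (Complex.continuous_ofReal.comp
      (hσ.snd.inner hσ.fst))).cexp

lemma RapidDecay.mul_of_norm_le_one (hH : RapidDecay ω H) {c : Space d × Space d → ℂ}
    (hc : ∀ z, ‖c z‖ ≤ 1) : RapidDecay ω (fun z => H z * c z) := by
  intro l hl
  obtain ⟨C, hC⟩ := hH l hl
  refine ⟨C, fun z => le_trans ?_ (hC z)⟩
  rw [norm_mul]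
  exact mul_le_mul_of_nonneg_left (mul_le_of_le_one_right (norm_nonneg _) (hc z))
    (Real.exp_nonneg _)

lemma WeightFunction.pair_swap_neg (ω : WeightFunction) (z : Space d × Space d) :
    ω.pair (z.2, -z.1) = ω.pair z := by
  simp only [WeightFunction.pair, WeightFunction.at_neg]
  ring

end synthesis

/-! ### Characters -/

lemma conj_character (ξ y : Space d) : (starRingEnd ℂ) (character ξ y) = character (-ξ) y := by
  rw [character, character, ← Complex.exp_conj, inner_neg_right]
  simp

lemma character_add_left (ξ η y : Space d) :
    character (ξ + η) y = character ξ y * character η y := by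
  rw [character, character, character, ← Complex.exp_add, inner_add_right]
  congr 1
  push_cast
  ring

lemma character_add_right (ξ x y : Space d) :
    character ξ (x + y) = character ξ x * character ξ y := by
  rw [character, character, character, ← Complex.exp_add, inner_add_left]
  congr 1
  push_cast
  ring

/-! ### The short-time Fourier transform of Schwartz functions -/

/-- The short-time Fourier transform `∫ g(y) conj(Π(z)θ(y)) dy` of `g` with window `θ`. -/
def analysis (θ g : 𝓢(Space d, ℂ)) (z : Space d × Space d) : ℂ :=
  ∫ y, g y * (starRingEnd ℂ) (atom θ z y)

lemma exists_norm_le (θ : 𝓢(Space d, ℂ)) : ∃ M : ℝ, ∀ y, ‖θ y‖ ≤ M := by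
  obtain ⟨C, -, hC⟩ := θ.decay 0 0
  exact ⟨C, fun y => by simpa using hC y⟩

lemma integrable_mul_conj_atom (θ g : 𝓢(Space d, ℂ)) (z : Space d × Space d) :
    Integrable (fun y => g y * (starRingEnd ℂ) (atom θ z y)) := by
  obtain ⟨M, hM⟩ := exists_norm_le θ
  refine (g.integrable.norm.mul_const M).mono' (g.continuous.mul
    (Complex.continuous_conj.comp (atom θ z).continuous)).aestronglyMeasurable
    (.of_forall fun y => ?_)
  rw [norm_mul, RCLike.norm_conj, norm_atom_apply]
  gcongr
  exact hM _

lemma analysis_add (θ f g : 𝓢(Space d, ℂ)) (z : Space d × Space d) :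
    analysis θ (f + g) z = analysis θ f z + analysis θ g z := by
  simp only [analysis, add_apply, add_mul]
  exact integral_add (integrable_mul_conj_atom θ f z) (integrable_mul_conj_atom θ g z)

lemma analysis_smul (θ g : 𝓢(Space d, ℂ)) (c : ℂ) (z : Space d × Space d) :
    analysis θ (c • g) z = c * analysis θ g z := by
  simp only [analysis, smul_apply, smul_eq_mul, mul_assoc]
  exact integral_const_mul _ _

lemma continuous_analysis (θ g : 𝓢(Space d, ℂ)) : Continuous (analysis θ g) := by
  obtain ⟨M, hM⟩ := exists_norm_le θ
  change Continuous fun z => ∫ y, g y * (starRingEnd ℂ) (atom θ z y)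
  refine continuous_of_dominated (F := fun z y => g y * (starRingEnd ℂ) (atom θ z y))
    (bound := fun y => ‖g y‖ * M)
    (fun z => (integrable_mul_conj_atom θ g z).aestronglyMeasurable)
    (fun z => .of_forall fun y => ?_) (g.integrable.norm.mul_const M) (.of_forall fun y => ?_)
  · rw [norm_mul, RCLike.norm_conj, norm_atom_apply]
    gcongr
    exact hM _
  · have hc : Continuous fun z => atom θ z y :=
      Continuous.comp (g := fun p : (Space d × Space d) × Space d => atom θ p.1 p.2)
        (f := fun z => (z, y)) (continuous_atom θ) (by fun_prop)
    exact continuous_const.mul (Complex.continuous_conj.comp hc)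

/-! ### Rapid decay of the short-time Fourier transform on `S_ω`. -/

lemma WeightedBounds.exists_norm_le {f : Space d → ℂ} (hf : WeightedBounds ω f) {l : ℝ}
    (hl : 0 < l) : ∃ C : ℝ, 0 ≤ C ∧ ∀ x, ‖f x‖ ≤ C * Real.exp (-(l * ω.at x)) := by
  obtain ⟨C, hC⟩ := (weightedBounds_iff ω f).1 hf l hl 0
  refine ⟨C, le_trans (by positivity) (hC 0), fun x => ?_⟩
  have := hC x
  rw [norm_iteratedFDeriv_zero] at this
  rwa [Real.exp_neg, ← div_eq_mul_inv, le_div_iff₀' (Real.exp_pos _)]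

/-- Subadditivity transfers the decay at `y` and `y - x` to `x`; the extra unit of decay of `f`
leaves `e^{-ω(y)}` to integrate. -/
lemma WeightedBounds.exists_integral_mul_translate_le {f g : 𝓢(Space d, ℂ)}
    (hf : WeightedBounds ω f) (hg : WeightedBounds ω g) (l : ℝ) (hl : 0 < l) :
    ∃ C : ℝ, 0 ≤ C ∧ ∀ x, ∫ y, ‖f y‖ * ‖g (y - x)‖ ≤ C * Real.exp (-(l * ω.at x)) := by
  obtain ⟨A, hA, hA'⟩ := hf.exists_norm_le (l := l + 1) (by positivity)
  obtain ⟨B, hB, hB'⟩ := hg.exists_norm_le hl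
  refine ⟨A * B * ∫ y : Space d, Real.exp (-ω.at y), mul_nonneg (mul_nonneg hA hB)
    (integral_nonneg fun y => Real.exp_nonneg _), fun x => ?_⟩
  have hb : ∀ y, ‖f y‖ * ‖g (y - x)‖
      ≤ A * B * Real.exp (-(l * ω.at x)) * Real.exp (-ω.at y) := by
    intro y
    have h1 : Real.exp (-((l + 1) * ω.at y)) * Real.exp (-(l * ω.at (y - x)))
        ≤ Real.exp (-(l * ω.at x)) * Real.exp (-ω.at y) := by
      rw [← Real.exp_add, ← Real.exp_add, Real.exp_le_exp]
      have h2 := ω.at_le_add x y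
      rw [← neg_sub y x, ω.at_neg] at h2
      have := mul_le_mul_of_nonneg_left h2 hl.le
      linarith
    calc _ ≤ (A * Real.exp (-((l + 1) * ω.at y))) * (B * Real.exp (-(l * ω.at (y - x)))) := by
          gcongr
          · exact hA' y
          · exact hB' _
      _ = A * B * (Real.exp (-((l + 1) * ω.at y)) * Real.exp (-(l * ω.at (y - x)))) := by ring
      _ ≤ A * B * (Real.exp (-(l * ω.at x)) * Real.exp (-ω.at y)) := by gcongr
      _ = _ := by ring
  refine (integral_mono_of_nonneg (.of_forall fun y => by positivity)
    ((ω.integrable_exp_neg_at d).const_mul _) (.of_forall hb)).trans (le_of_eq ?_)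
  rw [integral_const_mul]
  ring

lemma fourier_apply_eq_angularFourier (f : 𝓢(Space d, ℂ)) (η : Space d) :
    𝓕 f η = angularFourier d f ((2 * Real.pi) • η) := by
  have h : (2 * Real.pi)⁻¹ • (2 * Real.pi) • η = η := inv_smul_smul₀ (by positivity) η
  conv_lhs => rw [← h]
  rfl

lemma norm_analysis_le (θ g : 𝓢(Space d, ℂ)) (z : Space d × Space d) :
    ‖analysis θ g z‖ ≤ ∫ y, ‖g y‖ * ‖θ (y - z.1)‖ := by
  refine (norm_integral_le_integral_norm _).trans (le_of_eq ?_)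
  simp only [norm_mul, RCLike.norm_conj, norm_atom_apply]

/-- Parseval: on the Fourier side the atom is, in modulus, a translate by `ξ`. The factor comes from
the dilation `η ↦ 2πη` between the two normalizations. -/
lemma norm_analysis_le_fourier (θ g : 𝓢(Space d, ℂ)) (z : Space d × Space d) :
    ‖analysis θ g z‖ ≤ |((2 * Real.pi) ^ d)⁻¹| *
      ∫ η, ‖angularFourier d g η‖ * ‖angularFourier d θ (η - z.2)‖ := by
  have h := SchwartzMap.integral_inner_fourier_fourier (atom θ z) g
  simp only [RCLike.inner_apply] at h
  rw [analysis, ← h]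
  refine (norm_integral_le_integral_norm _).trans (le_of_eq ?_)
  have h2 := Measure.integral_comp_smul (volume : Measure (Space d))
    (fun η => ‖angularFourier d g η‖ * ‖angularFourier d θ (η - z.2)‖) (2 * Real.pi)
  rw [finrank_euclideanSpace_fin, smul_eq_mul] at h2
  rw [← h2]
  congr 1
  ext η
  rw [norm_mul, RCLike.norm_conj, fourier_apply_eq_angularFourier, fourier_apply_eq_angularFourier,
    angularFourier_atom, norm_mul, norm_character, one_mul, norm_atom_apply]

/-- The larger of `ω(x)` and `ω(ξ)` is at least half their sum, so decay of rate `2l` in each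
variable separately gives rate `l` jointly. -/
lemma rapidDecay_analysis {θ g : 𝓢(Space d, ℂ)} (hθ : WeightedBounds ω θ)
    (hθ' : WeightedBounds ω (angularFourier d θ)) (hg : WeightedBounds ω g)
    (hg' : WeightedBounds ω (angularFourier d g)) : RapidDecay ω (analysis θ g) := by
  intro l hl
  obtain ⟨A, hA, hA'⟩ := hg.exists_integral_mul_translate_le hθ (2 * l) (by positivity)
  obtain ⟨B, hB, hB'⟩ := hg'.exists_integral_mul_translate_le hθ' (2 * l) (by positivity)
  set D := |((2 * Real.pi) ^ d)⁻¹|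
  refine ⟨A + D * B, fun z => ?_⟩
  have h1 := (norm_analysis_le θ g z).trans (hA' z.1)
  have h2 := (norm_analysis_le_fourier θ g z).trans
    (mul_le_mul_of_nonneg_left (hB' z.2) (abs_nonneg _))
  rw [← le_div_iff₀' (Real.exp_pos _), div_eq_mul_inv, ← Real.exp_neg, add_mul]
  have hn : 0 ≤ D * B := mul_nonneg (abs_nonneg _) hB
  rcases le_total (ω.at z.1) (ω.at z.2) with h | h
  · have h3 : Real.exp (-(2 * l * ω.at z.2)) ≤ Real.exp (-(l * ω.pair z)) := by
      rw [Real.exp_le_exp, WeightFunction.pair]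
      nlinarith
    have h4 : D * (B * Real.exp (-(2 * l * ω.at z.2))) ≤ D * B * Real.exp (-(l * ω.pair z)) := by
      rw [← mul_assoc]; gcongr
    have : 0 ≤ A * Real.exp (-(l * ω.pair z)) := by positivity
    linarith
  · have h3 : Real.exp (-(2 * l * ω.at z.1)) ≤ Real.exp (-(l * ω.pair z)) := by
      rw [Real.exp_le_exp, WeightFunction.pair]
      nlinarith
    have h4 : A * Real.exp (-(2 * l * ω.at z.1)) ≤ A * Real.exp (-(l * ω.pair z)) := by gcongr
    have : 0 ≤ D * B * Real.exp (-(l * ω.pair z)) := by positivity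
    linarith

/-! ### Inversion and reproducing formulas. -/

lemma RapidDecay.integrable_snd {H : Space d × Space d → ℂ} (hH : RapidDecay ω H)
    (hc : Continuous H) (x : Space d) : Integrable (fun ξ => H (x, ξ)) := by
  obtain ⟨C, hC⟩ := hH 1 one_pos
  refine ((ω.integrable_exp_neg_at d).const_mul C).mono'
    (hc.comp (continuous_const.prodMk continuous_id)).aestronglyMeasurable (.of_forall fun ξ => ?_)
  rw [Real.exp_neg, ← div_eq_mul_inv, le_div_iff₀' (Real.exp_pos _)]
  refine le_trans ?_ (hC (x, ξ))
  gcongr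
  simp only [WeightFunction.pair]
  linarith [ω.at_nonneg x]

/-- Fourier inversion in the frequency variable of the short-time Fourier transform. -/
lemma integral_analysis_mul_character {θ g : 𝓢(Space d, ℂ)} (h : RapidDecay ω (analysis θ g))
    (x y : Space d) : ∫ ξ, analysis θ g (x, ξ) * character ξ y
      = (2 * Real.pi) ^ d * (g y * (starRingEnd ℂ) (θ (y - x))) := by
  set k : Space d → ℂ := fun t => g t * (starRingEnd ℂ) (θ (t - x)) with hk
  have hkc : Continuous k := g.continuous.mul
    (Complex.continuous_conj.comp (θ.continuous.comp (continuous_id.sub continuous_const)))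
  have hki : Integrable k := by
    obtain ⟨M, hM⟩ := exists_norm_le θ
    refine (g.integrable.norm.mul_const M).mono' hkc.aestronglyMeasurable (.of_forall fun y => ?_)
    rw [norm_mul, RCLike.norm_conj]
    gcongr
    exact hM _
  -- For fixed `x`, the short-time transform is the Fourier transform of `k` up to dilation. Its
  -- decay makes `𝓕 k` integrable, as pointwise inversion requires.
  have hF : ∀ η, 𝓕 k η = analysis θ g (x, (2 * Real.pi) • η) := by
    intro η
    rw [Real.fourier_eq', analysis]
    congr 1
    ext t
    rw [atom_apply, map_mul, conj_character, hk, character, smul_eq_mul, inner_neg_right,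
      real_inner_smul_right, mul_left_comm]
    congr 2
    congr 1
    push_cast
    ring
  have hFi : Integrable (𝓕 k) := by
    have := (h.integrable_snd (continuous_analysis θ g) x).comp_smul
      (R := 2 * Real.pi) (by positivity)
    exact this.congr (.of_forall fun η => (hF η).symm)
  have hinv := congrFun (hkc.fourierInv_fourier_eq hki hFi) y
  rw [Real.fourierInv_eq'] at hinv
  have h2 := Measure.integral_comp_smul (volume : Measure (Space d))
    (fun ξ => analysis θ g (x, ξ) * character ξ y) (2 * Real.pi)
  have h3 : ∫ ξ, analysis θ g (x, (2 * Real.pi) • ξ) * character ((2 * Real.pi) • ξ) y = k y := by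
    rw [← hinv]
    congr 1
    ext η
    rw [← hF, character, smul_eq_mul, real_inner_smul_right, mul_comm, real_inner_comm]
    congr 2
    push_cast
    ring
  rw [h3, finrank_euclideanSpace_fin, abs_of_nonneg (by positivity), Complex.real_smul] at h2
  change _ = _ * k y
  rw [h2, ← mul_assoc]
  have : ((2 * Real.pi : ℂ)) ^ d ≠ 0 := by
    apply pow_ne_zero
    exact_mod_cast Real.two_pi_pos.ne'
  push_cast
  rw [mul_inv_cancel₀ this, one_mul]

/-- The constant `(2π)^d ‖θ‖²` in the inversion formula. -/
def inversionConstant (θ : 𝓢(Space d, ℂ)) : ℂ :=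
  (2 * Real.pi) ^ d * ∫ y, θ y * (starRingEnd ℂ) (θ y)

lemma inversionConstant_ne_zero {θ : 𝓢(Space d, ℂ)} (hθ : θ ≠ 0) : inversionConstant θ ≠ 0 := by
  refine mul_ne_zero (pow_ne_zero _ (by exact_mod_cast Real.two_pi_pos.ne')) ?_
  have h : ∫ y, θ y * (starRingEnd ℂ) (θ y) = ((∫ y, ‖θ y‖ ^ 2 : ℝ) : ℂ) := by
    rw [← integral_complex_ofReal]
    congr 1
    ext y
    rw [Complex.mul_conj, Complex.normSq_eq_norm_sq]
  rw [h, Complex.ofReal_ne_zero]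
  obtain ⟨y, hy⟩ : ∃ y, θ y ≠ 0 := by
    by_contra! h0
    exact hθ (SchwartzMap.ext h0)
  have hi : Integrable (fun y => ‖θ y‖ ^ 2) := by
    obtain ⟨M, hM⟩ := exists_norm_le θ
    refine (θ.integrable.norm.mul_const M).mono' (θ.continuous.norm.pow 2).aestronglyMeasurable
      (.of_forall fun y => ?_)
    rw [Real.norm_of_nonneg (by positivity), sq]
    gcongr
    exact hM y
  exact (integral_pos_of_integrable_nonneg_nonzero (x := y) (θ.continuous.norm.pow 2) hi
    (fun y => sq_nonneg _) (pow_ne_zero 2 (norm_ne_zero_iff.2 hy))).ne'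

/-- The inversion formula of the short-time Fourier transform. -/
lemma synthesis_analysis {θ g : 𝓢(Space d, ℂ)} (h : RapidDecay ω (analysis θ g)) (y : Space d) :
    synthesis θ id (analysis θ g) y = inversionConstant θ * g y := by
  have hi := integrable_mul_atom (continuous_analysis θ g).aestronglyMeasurable h continuous_id θ y
  rw [synthesis, Measure.volume_eq_prod, integral_prod _ hi]
  have h1 : ∀ x, ∫ ξ, analysis θ g (x, ξ) * atom θ (id (x, ξ)) y
      = (2 * Real.pi) ^ d * g y * (θ (y - x) * (starRingEnd ℂ) (θ (y - x))) := by
    intro x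
    simp only [id, atom_apply, ← mul_assoc]
    rw [integral_mul_const, integral_analysis_mul_character h]
    ring
  simp only [h1]
  rw [integral_const_mul, integral_sub_left_eq_self (fun y => θ y * (starRingEnd ℂ) (θ y)),
    inversionConstant]
  ring

/-- Covariance, by translating the integration variable: up to a phase, the reproducing kernel
depends only on `w - z`. -/
lemma analysis_atom (θ : 𝓢(Space d, ℂ)) (z w : Space d × Space d) :
    analysis θ (atom θ z) w = character (z.2 - w.2) z.1 * analysis θ θ (w - z) := by
  rw [analysis, analysis, ← integral_const_mul,
    ← integral_add_right_eq_self (fun y => atom θ z y * (starRingEnd ℂ) (atom θ w y)) z.1]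
  congr 1
  ext y
  simp only [atom_apply, map_mul, conj_character, Prod.fst_sub, Prod.snd_sub, add_sub_cancel_right,
    sub_eq_add_neg z.2, character_add_left, character_add_right, neg_sub]
  rw [show y + z.1 - w.1 = y - (w.1 - z.1) by abel]
  ring

lemma continuous_analysis_atom (θ : 𝓢(Space d, ℂ)) :
    Continuous (fun p : (Space d × Space d) × (Space d × Space d) =>
      analysis θ (atom θ p.1) p.2) := by
  simp only [analysis_atom]
  refine Continuous.mul ?_ ((continuous_analysis θ θ).comp (continuous_snd.sub continuous_fst))
  simp only [character]
  exact (continuous_const.mul (Complex.continuous_ofReal.comp (continuous_fst.fst.inner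
    (continuous_fst.snd.sub continuous_snd.snd)))).cexp

lemma exists_norm_analysis_atom_le {θ : 𝓢(Space d, ℂ)} (h : RapidDecay ω (analysis θ θ)) (l : ℝ)
    (hl : 0 < l) : ∃ C : ℝ, 0 ≤ C ∧ ∀ z w : Space d × Space d,
      ‖analysis θ (atom θ z) w‖ ≤ C * (Real.exp (l * ω.pair z) * Real.exp (-(l * ω.pair w))) := by
  obtain ⟨C, hC⟩ := h l hl
  have hC0 : 0 ≤ C := le_trans (by positivity) (hC 0)
  refine ⟨C, hC0, fun z w => ?_⟩
  rw [analysis_atom, norm_mul, norm_character, one_mul]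
  have h1 := hC (w - z)
  rw [← le_div_iff₀' (Real.exp_pos _), div_eq_mul_inv, ← Real.exp_neg] at h1
  refine h1.trans ?_
  gcongr
  rw [← Real.exp_add, Real.exp_le_exp]
  have := mul_le_mul_of_nonneg_left (ω.pair_le_add w z) hl.le
  linarith

/-- The reproducing formula of the short-time Fourier transform. -/
lemma integral_analysis_mul_analysis_atom {θ g : 𝓢(Space d, ℂ)}
    (h : RapidDecay ω (analysis θ g)) (w : Space d × Space d) :
    ∫ z, analysis θ g z * analysis θ (atom θ z) w = inversionConstant θ * analysis θ g w := by
  obtain ⟨M, hM⟩ := exists_norm_le θ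
  have h1 := integral_synthesis_mul (continuous_analysis θ g).aestronglyMeasurable h continuous_id θ
    (k := fun y => (starRingEnd ℂ) (atom θ w y)) (Complex.continuous_conj.comp
      (atom θ w).continuous) (M := M) (fun y => by
        rw [RCLike.norm_conj, norm_atom_apply]; exact hM _)
  simp only [synthesis_analysis h, mul_assoc, id] at h1
  rw [integral_const_mul] at h1
  exact h1.symm

/-! ### Square integrable representation of functionals -/

/-- A linear functional that is bounded by the norm of a linear map into a Hilbert space is
represented by a vector of this space. -/
lemma exists_inner_eq {V E : Type*} [AddCommGroup V] [Module ℂ V] [NormedAddCommGroup E]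
    [InnerProductSpace ℂ E] [CompleteSpace E] (J : V →ₗ[ℂ] E) (u : V →ₗ[ℂ] ℂ) (C : ℝ)
    (h : ∀ g, ‖u g‖ ≤ C * ‖J g‖) : ∃ e : E, ∀ g, u g = inner ℂ e (J g) := by
  -- A purely algebraic section carries `u` to the range of `J`, where the bound makes it
  -- continuous; Hahn-Banach and Riesz finish. Independence of the section holds because the bound
  -- forces `u` to vanish on the kernel of `J` (`h2`).
  obtain ⟨s, hs⟩ := J.rangeRestrict.exists_rightInverse_of_surjective J.range_rangeRestrict
  have hs' : ∀ w : LinearMap.range J, J (s w) = w := fun w =>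
    congrArg Subtype.val (LinearMap.congr_fun hs w)
  let v : StrongDual ℂ (LinearMap.range J) := (u ∘ₗ s).mkContinuous C fun w => by
    have := h (s w)
    rwa [hs'] at this
  obtain ⟨U, hU, -⟩ := exists_extension_norm_eq (LinearMap.range J) v
  refine ⟨(InnerProductSpace.toDual ℂ E).symm U, fun g => ?_⟩
  rw [InnerProductSpace.toDual_symm_apply]
  have h1 : U (J g) = u (s (J.rangeRestrict g)) := hU (J.rangeRestrict g)
  have h2 := h (g - s (J.rangeRestrict g))
  have h3 : ((J.rangeRestrict g : LinearMap.range J) : E) = J g := rfl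
  rw [map_sub, map_sub, hs', h3, sub_self, norm_zero, mul_zero] at h2
  rw [h1, ← sub_eq_zero]
  exact norm_le_zero_iff.1 h2

lemma integral_norm_mul_le_eLpNorm_two {α : Type*} [MeasurableSpace α] {μ : Measure α}
    {f g : α → ℂ} (hf : MemLp f 2 μ) (hg : MemLp g 2 μ) :
    ∫ a, ‖f a * g a‖ ∂μ ≤ (eLpNorm f 2 μ).toReal * (eLpNorm g 2 μ).toReal := by
  have h := eLpNorm_smul_le_mul_eLpNorm (p := 2) (q := 2) (r := 1) hg.1 hf.1
  change ∫ a, ‖(f * g) a‖ ∂μ ≤ _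
  rw [integral_norm_eq_lintegral_enorm (hf.1.mul hg.1), ← eLpNorm_one_eq_lintegral_enorm,
    ← ENNReal.toReal_mul]
  exact ENNReal.toReal_mono (ENNReal.mul_ne_top hf.2.ne hg.2.ne) h

lemma RapidDecay.memLp_two {H : Space d × Space d → ℂ} (hH : RapidDecay ω H) (hc : Continuous H)
    {l : ℝ} (hl : 0 < l) :
    MemLp (fun z => (Real.exp (l * ω.pair z) : ℂ) * H z) 2 := by
  have hcont : Continuous (fun z => (Real.exp (l * ω.pair z) : ℂ) * H z) :=
    (Complex.continuous_ofReal.comp (continuous_const.mul ω.continuous_pair).rexp).mul hc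
  rw [memLp_two_iff_integrable_sq_norm hcont.aestronglyMeasurable]
  obtain ⟨C, hC⟩ := hH (l + 1) (by positivity)
  refine ((ω.integrable_exp_neg_pair d).const_mul (C ^ 2)).mono'
    (hcont.norm.pow 2).aestronglyMeasurable (.of_forall fun z => ?_)
  have h1 := hC z
  rw [add_mul, one_mul, Real.exp_add, mul_right_comm, ← le_div_iff₀ (Real.exp_pos _),
    div_eq_mul_inv, ← Real.exp_neg] at h1
  rw [Real.norm_of_nonneg (by positivity), norm_mul, Complex.norm_real,
    Real.norm_of_nonneg (Real.exp_nonneg _)]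
  have h2 : Real.exp (-ω.pair z) ≤ 1 := Real.exp_le_one_iff.2 (neg_nonpos.2 (ω.pair_nonneg z))
  calc _ ≤ (C * Real.exp (-ω.pair z)) ^ 2 := by gcongr
    _ = C ^ 2 * (Real.exp (-ω.pair z) * Real.exp (-ω.pair z)) := by ring
    _ ≤ C ^ 2 * (Real.exp (-ω.pair z) * 1) := by gcongr
    _ = _ := by ring

lemma memLp_two_exp_neg_pair (ω : WeightFunction) (d : ℕ) :
    MemLp (fun z : Space d × Space d => (Real.exp (-ω.pair z) : ℂ)) 2 := by
  have hcont : Continuous (fun z : Space d × Space d => (Real.exp (-ω.pair z) : ℂ)) :=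
    Complex.continuous_ofReal.comp ω.continuous_pair.neg.rexp
  rw [memLp_two_iff_integrable_sq_norm hcont.aestronglyMeasurable]
  refine (ω.integrable_exp_neg_pair d).mono' (hcont.norm.pow 2).aestronglyMeasurable
    (.of_forall fun z => ?_)
  have h2 : Real.exp (-ω.pair z) ≤ 1 := Real.exp_le_one_iff.2 (neg_nonpos.2 (ω.pair_nonneg z))
  rw [Real.norm_of_nonneg (by positivity), Complex.norm_real,
    Real.norm_of_nonneg (Real.exp_nonneg _), sq]
  exact mul_le_of_le_one_right (Real.exp_nonneg _) h2

/-! ### Representation and reconstruction of functionals on `S_ω`. -/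

namespace SOmega

/-- The time-frequency shift of an element of `S_ω`. -/
def shift (θ : SOmega ω d) (z : Space d × Space d) : SOmega ω d := phaseShift (WithLp.toLp 2 z) θ

lemma toSchwartz_shift (θ : SOmega ω d) (z : Space d × Space d) :
    toSchwartz (θ.shift z) = atom (toSchwartz θ) z := rfl

lemma toSchwartz_injective : Function.Injective (toSchwartz : SOmega ω d → 𝓢(Space d, ℂ)) :=
  Subtype.val_injective

lemma rapidDecay_analysis (θ g : SOmega ω d) :
    RapidDecay ω (analysis (toSchwartz θ) (toSchwartz g)) :=
  UltraGabor.rapidDecay_analysis θ.weightedBounds θ.weightedBounds_fourier g.weightedBounds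
    g.weightedBounds_fourier

lemma coe_eq_synthesis {θ : SOmega ω d} (hθ : θ ≠ 0) (g : SOmega ω d) :
    (g : Space d → ℂ) = synthesis (toSchwartz θ) id
      (fun z => analysis (toSchwartz θ) (toSchwartz g) z * (inversionConstant (toSchwartz θ))⁻¹) := by
  ext y
  have hκ : inversionConstant (toSchwartz θ) ≠ 0 :=
    inversionConstant_ne_zero ((map_ne_zero_iff _ toSchwartz_injective).2 hθ)
  have h := synthesis_analysis (rapidDecay_analysis θ g) y
  simp only [synthesis] at h ⊢
  simp only [mul_right_comm _ _ (atom _ _ y)]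
  rw [integral_mul_const, h]
  field_simp

/-- By inversion `g` is a superposition with density `κ⁻¹ V_θ g`, and the bounds for superpositions
have constants independent of the density. For the seminorms of the Fourier transform, the
quarter-turned superposition is used. -/
lemma exists_seminorm_le {θ : SOmega ω d} (hθ : θ ≠ 0) (i : SeminormIndex) :
    ∃ C L : ℝ, 0 ≤ C ∧ 0 < L ∧ ∀ g : SOmega ω d, sOmegaSeminorms ω d i g
      ≤ C * ∫ z, ‖analysis (toSchwartz θ) (toSchwartz g) z‖ * Real.exp (L * ω.pair z) := by
  set κ := inversionConstant (toSchwartz θ)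
  have hm : ∀ g : SOmega ω d, AEStronglyMeasurable
      (fun z => analysis (toSchwartz θ) (toSchwartz g) z * κ⁻¹) := fun g =>
    ((continuous_analysis _ _).mul continuous_const).aestronglyMeasurable
  have hH : ∀ g : SOmega ω d, RapidDecay ω
      (fun z => analysis (toSchwartz θ) (toSchwartz g) z * κ⁻¹) := by
    intro g l hl
    obtain ⟨C, hC⟩ := rapidDecay_analysis θ g l hl
    refine ⟨C * ‖κ⁻¹‖, fun z => ?_⟩
    rw [norm_mul, ← mul_assoc]
    exact mul_le_mul_of_nonneg_right (hC z) (norm_nonneg _)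
  have hint : ∀ (g : SOmega ω d) (L : ℝ),
      ∫ z, ‖analysis (toSchwartz θ) (toSchwartz g) z * κ⁻¹‖ * Real.exp (L * ω.pair z)
        = ‖κ⁻¹‖ * ∫ z, ‖analysis (toSchwartz θ) (toSchwartz g) z‖ * Real.exp (L * ω.pair z) := by
    intro g L
    rw [← integral_const_mul]
    congr 1
    ext z
    rw [norm_mul]
    ring
  rcases i with ⟨l, n⟩ | ⟨l, n⟩
  · obtain ⟨C, L, hC, hL, h⟩ := exists_iteratedFDeriv_synthesis_le θ.weightedBounds continuous_id
      (fun z => rfl) l l.2 n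
    refine ⟨C * ‖κ⁻¹‖, L, by positivity, hL, fun g => ?_⟩
    refine ciSup_le fun y => ?_
    rw [coe_eq_synthesis hθ g, mul_assoc, ← hint]
    exact h _ (hm g) (hH g) y
  · obtain ⟨C, L, hC, hL, h⟩ := exists_iteratedFDeriv_synthesis_le
      (σ := fun z : Space d × Space d => (z.2, -z.1)) θ.weightedBounds_fourier
      (continuous_snd.prodMk continuous_fst.neg) (fun z => ω.pair_swap_neg z) l l.2 n
    refine ⟨C * ‖κ⁻¹‖, L, by positivity, hL, fun g => ?_⟩
    refine ciSup_le fun y => ?_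
    rw [angularFourier_eq_synthesis (hm g) (hH g) continuous_id
      (fun y => congrFun (coe_eq_synthesis hθ g) y), mul_assoc, ← hint]
    have h2 := h _ ((hm g).mul (continuous_character_comp continuous_id).aestronglyMeasurable)
      ((hH g).mul_of_norm_le_one fun z => (norm_character _ _).le) y
    refine h2.trans (le_of_eq ?_)
    congr 2
    ext z
    rw [Pi.mul_apply, norm_mul, norm_character, mul_one]

lemma exists_norm_apply_le {θ : SOmega ω d} (hθ : θ ≠ 0) (u : SOmegaDual ω d) :
    ∃ C L : ℝ, 0 ≤ C ∧ 0 < L ∧ ∀ g : SOmega ω d, ‖u g‖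
      ≤ C * ∫ z, ‖analysis (toSchwartz θ) (toSchwartz g) z‖ * Real.exp (L * ω.pair z) := by
  obtain ⟨s, D, -, hs⟩ := Seminorm.bound_of_continuous (sOmega_withSeminorms ω d)
    ((normSeminorm ℂ ℂ).comp u.toLinearMap) (continuous_norm.comp u.continuous)
  choose C L hC hL h using exists_seminorm_le hθ
  -- The sums dominate each `C i` and `L i`; the `1` keeps the exponent positive if `s` is empty.
  refine ⟨D * ∑ i ∈ s, C i, 1 + ∑ i ∈ s, L i, mul_nonneg D.2 (Finset.sum_nonneg fun i _ => hC i),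
    add_pos_of_pos_of_nonneg one_pos (Finset.sum_nonneg fun i _ => (hL i).le), fun g => ?_⟩
  have h1 : ‖u g‖ ≤ D * (s.sup (sOmegaSeminorms ω d)) g := hs g
  refine h1.trans ?_
  rw [mul_assoc]
  refine mul_le_mul_of_nonneg_left (Seminorm.finset_sup_apply_le (mul_nonneg
    (Finset.sum_nonneg fun i _ => hC i) (integral_nonneg fun z => by positivity))
    fun i hi => (h i g).trans ?_) D.2
  have hint := (rapidDecay_analysis θ g).integrable_exp_mul
    (continuous_analysis _ _).aestronglyMeasurable
  refine mul_le_mul (Finset.single_le_sum (fun i _ => hC i) hi)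
    (integral_mono (hint _) (hint _) fun z => ?_) (integral_nonneg fun z => by positivity)
    (Finset.sum_nonneg fun i _ => hC i)
  have h2 : L i ≤ 1 + ∑ i ∈ s, L i :=
    (Finset.single_le_sum (fun i _ => (hL i).le) hi).trans (by linarith)
  have := ω.pair_nonneg z
  dsimp only
  gcongr

/-- The functional `u` is represented on the short-time Fourier transform side by a square
integrable function times an exponential weight. -/
lemma exists_representation {θ : SOmega ω d} (hθ : θ ≠ 0) (u : SOmegaDual ω d) :
    ∃ l : ℝ, 0 < l ∧ ∃ h : Space d × Space d → ℂ, MemLp h 2 ∧ ∀ g : SOmega ω d,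
      u g = ∫ z, analysis (toSchwartz θ) (toSchwartz g) z * (Real.exp (l * ω.pair z) * h z) := by
  obtain ⟨C, L, hC, hL, h⟩ := exists_norm_apply_le hθ u
  -- Writing `e^{Lω} = e^{-ω} e^{(L+1)ω}` with `e^{-ω}` in `L²`, Cauchy-Schwarz turns the weighted
  -- `L¹` bound into a weighted `L²` bound.
  have hL1 : 0 < L + 1 := by positivity
  have hmem : ∀ g : SOmega ω d, MemLp (fun z => (Real.exp ((L + 1) * ω.pair z) : ℂ) *
      analysis (toSchwartz θ) (toSchwartz g) z) 2 := fun g =>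
    (rapidDecay_analysis θ g).memLp_two (continuous_analysis _ _) hL1
  let J : SOmega ω d →ₗ[ℂ] Lp ℂ 2 (volume : Measure (Space d × Space d)) :=
    { toFun := fun g => (hmem g).toLp _
      map_add' := fun f g => by
        rw [← MemLp.toLp_add]
        congr 1
        ext z
        rw [map_add, analysis_add, Pi.add_apply, mul_add]
      map_smul' := fun c g => by
        rw [RingHom.id_apply, ← MemLp.toLp_const_smul]
        congr 1
        ext z
        rw [map_smul, analysis_smul, Pi.smul_apply, smul_eq_mul, mul_left_comm] }
  set N := (eLpNorm (fun z : Space d × Space d => (Real.exp (-ω.pair z) : ℂ)) 2 volume).toReal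
  have hJ : ∀ g, ‖u g‖ ≤ C * N * ‖J g‖ := by
    intro g
    have h1 := integral_norm_mul_le_eLpNorm_two (memLp_two_exp_neg_pair ω d) (hmem g)
    have h2 : ‖J g‖ = _ := Lp.norm_toLp _ (hmem g)
    rw [h2, mul_assoc]
    refine (h g).trans (mul_le_mul_of_nonneg_left ((le_of_eq ?_).trans h1) hC)
    congr 1
    ext z
    rw [norm_mul, norm_mul, Complex.norm_real, Complex.norm_real,
      Real.norm_of_nonneg (Real.exp_nonneg _), Real.norm_of_nonneg (Real.exp_nonneg _),
      ← mul_assoc, ← Real.exp_add, mul_comm]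
    congr 2
    ring
  obtain ⟨e, he⟩ := exists_inner_eq J u.toLinearMap (C * N) hJ
  -- The inner product is conjugate linear in its first argument, hence the conjugate.
  refine ⟨L + 1, hL1, fun z => (starRingEnd ℂ) (e z), (Lp.memLp e).star, fun g => ?_⟩
  have h1 : u g = inner ℂ e (J g) := he g
  rw [h1, L2.inner_def]
  refine integral_congr_ae ?_
  filter_upwards [(hmem g).coeFn_toLp] with z hz
  have h2 : (J g : Space d × Space d → ℂ) z = _ := hz
  rw [h2, RCLike.inner_apply]
  ring

/-- The kernel bound with exponent `l + 1` beats `e^{lω(w)}`, leaving the integrable `e^{-ω(w)}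
h(w)`; its growth in `z` is absorbed by `V_θ g`. -/
lemma integrable_analysis_mul_analysis_atom (θ g : SOmega ω d) (l : ℝ) (hl : 0 < l)
    {h : Space d × Space d → ℂ} (hh : MemLp h 2) :
    Integrable (fun p : (Space d × Space d) × (Space d × Space d) =>
      analysis (toSchwartz θ) (toSchwartz g) p.1 * analysis (toSchwartz θ)
        (atom (toSchwartz θ) p.1) p.2 * (Real.exp (l * ω.pair p.2) * h p.2))
      (volume.prod volume) := by
  obtain ⟨C, hC, hC'⟩ := exists_norm_analysis_atom_le (rapidDecay_analysis θ θ) (l + 1)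
    (by positivity)
  have h1 := (rapidDecay_analysis θ g).integrable_exp_mul
    (continuous_analysis _ _).aestronglyMeasurable (l + 1)
  have h2 : Integrable (fun z => (Real.exp (-ω.pair z) : ℂ) * h z) :=
    (memLp_two_exp_neg_pair ω d).integrable_mul hh
  refine ((h1.mul_prod h2.norm).const_mul C).mono'
    ((((continuous_analysis _ _).comp continuous_fst).mul
      (continuous_analysis_atom _)).aestronglyMeasurable.mul
      ((Complex.continuous_ofReal.comp (continuous_const.mul
        (ω.continuous_pair.comp continuous_snd)).rexp).aestronglyMeasurable.mul hh.1.comp_snd))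
    (.of_forall fun p => ?_)
  rw [norm_mul, norm_mul, norm_mul, norm_mul, Complex.norm_real, Complex.norm_real,
    Real.norm_of_nonneg (Real.exp_nonneg _), Real.norm_of_nonneg (Real.exp_nonneg _)]
  have he : Real.exp (-((l + 1) * ω.pair p.2)) * Real.exp (l * ω.pair p.2)
      = Real.exp (-ω.pair p.2) := by
    rw [← Real.exp_add]
    ring_nf
  calc _ ≤ ‖analysis (toSchwartz θ) (toSchwartz g) p.1‖ *
        (C * (Real.exp ((l + 1) * ω.pair p.1) * Real.exp (-((l + 1) * ω.pair p.2)))) *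
        (Real.exp (l * ω.pair p.2) * ‖h p.2‖) := by gcongr; exact hC' _ _
    _ = C * (‖analysis (toSchwartz θ) (toSchwartz g) p.1‖ * Real.exp ((l + 1) * ω.pair p.1) *
        ((Real.exp (-((l + 1) * ω.pair p.2)) * Real.exp (l * ω.pair p.2)) * ‖h p.2‖)) := by ring
    _ = _ := by rw [he]

/-- Through the representation, `u(Π(z)θ)` is a parametric integral of a jointly measurable
function, so continuity of the shifts in `S_ω` is not needed. -/
lemma aestronglyMeasurable_apply_shift {θ : SOmega ω d} (hθ : θ ≠ 0) (u : SOmegaDual ω d) :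
    AEStronglyMeasurable (fun z => u (θ.shift z)) := by
  obtain ⟨l, -, h, hh, hu⟩ := exists_representation hθ u
  simp only [hu, toSchwartz_shift]
  exact AEStronglyMeasurable.integral_prod_right' (μ := volume) (ν := volume)
    (f := fun p : (Space d × Space d) × (Space d × Space d) =>
      analysis (toSchwartz θ) (atom (toSchwartz θ) p.1) p.2 * (Real.exp (l * ω.pair p.2) * h p.2))
    ((continuous_analysis_atom _).aestronglyMeasurable.mul
      ((Complex.continuous_ofReal.comp (continuous_const.mul
        (ω.continuous_pair.comp continuous_snd)).rexp).aestronglyMeasurable.mul hh.1.comp_snd))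

/-- A functional is recovered from its short-time Fourier transform. -/
lemma integral_analysis_mul_apply_shift {θ : SOmega ω d} (hθ : θ ≠ 0) (u : SOmegaDual ω d)
    (g : SOmega ω d) :
    ∫ z, analysis (toSchwartz θ) (toSchwartz g) z * u (θ.shift z)
      = inversionConstant (toSchwartz θ) * u g := by
  obtain ⟨l, hl, h, hh, hu⟩ := exists_representation hθ u
  -- Integrating in `w` first produces `u(Π(z)θ)`; integrating in `z` first produces `κ V_θ g(w)` by
  -- the reproducing formula.
  have hswap := integral_integral_swap (f := fun z w => analysis (toSchwartz θ) (toSchwartz g) z *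
    analysis (toSchwartz θ) (atom (toSchwartz θ) z) w * (Real.exp (l * ω.pair w) * h w))
    (integrable_analysis_mul_analysis_atom θ g l hl hh)
  simp only [hu, toSchwartz_shift, ← integral_const_mul]
  simp only [integral_mul_const,
    integral_analysis_mul_analysis_atom (rapidDecay_analysis θ g)] at hswap
  simp only [mul_assoc] at hswap ⊢
  exact hswap

lemma conj_atom (θ : 𝓢(Space d, ℂ)) (z : Space d × Space d) (y : Space d) :
    (starRingEnd ℂ) (atom θ z y) = atom (conjugate θ) (z.1, -z.2) y := by
  rw [atom_apply, atom_apply, map_mul, conj_character, conjugate_apply]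

/-- A functional whose short-time Fourier transform decays rapidly is given by an element of
`S_ω`. -/
lemma isInSOmega_of_rapidDecay {θ : SOmega ω d} (hθ : θ ≠ 0) {u : SOmegaDual ω d}
    (hu : RapidDecay ω (fun z => u (θ.shift z))) : u.IsInSOmega := by
  set κ := inversionConstant (toSchwartz θ)
  have hκ : κ ≠ 0 := inversionConstant_ne_zero ((map_ne_zero_iff _ toSchwartz_injective).2 hθ)
  -- The synthesizing atoms are the conjugates of `Π(z)θ`, because functions act on `g` by the
  -- bilinear pairing `∫ f g`; conjugation reverses the frequency.
  set σ : Space d × Space d → Space d × Space d := fun z => (z.1, -z.2)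
  have hσ : Continuous σ := continuous_fst.prodMk continuous_snd.neg
  have hσω : ∀ z, ω.pair (σ z) = ω.pair z := fun z => by
    simp only [σ, WeightFunction.pair, WeightFunction.at_neg]
  have hm := aestronglyMeasurable_apply_shift hθ u
  set θ' := conjugate (toSchwartz θ)
  have hθ₁ : WeightedBounds ω θ' := θ.conj.weightedBounds
  have hθ₂ : WeightedBounds ω (angularFourier d θ') := θ.conj.weightedBounds_fourier
  let f₀ : 𝓢(Space d, ℂ) := (weightedBounds_synthesis hθ₁ hσ hσω hm hu).toSchwartzMap
    (contDiff_synthesis hθ₁ hσ hσω hm hu)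
  have hf₀ : ∀ y, f₀ y = synthesis θ' σ (fun z => u (θ.shift z)) y := fun y => rfl
  let f : SOmega ω d := ⟨f₀, weightedBounds_synthesis hθ₁ hσ hσω hm hu, by
    rw [angularFourier_eq_synthesis hm hu hσ hf₀]
    exact weightedBounds_synthesis hθ₂ (hσ.snd.prodMk hσ.fst.neg)
      (fun z => (ω.pair_swap_neg _).trans (hσω z))
      (hm.mul (continuous_character_comp hσ).aestronglyMeasurable)
      (hu.mul_of_norm_le_one fun z => (norm_character _ _).le)⟩
  refine ⟨κ⁻¹ • f, fun g => ?_⟩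
  obtain ⟨M, hM⟩ := exists_norm_le (toSchwartz g)
  have h1 := integral_synthesis_mul hm hu hσ θ' (toSchwartz g).continuous hM
  have h2 := integral_analysis_mul_apply_shift hθ u g
  have h3 : ∀ y, toSchwartz (κ⁻¹ • f) y = κ⁻¹ * synthesis θ' σ (fun z => u (θ.shift z)) y := by
    intro y
    rw [map_smul, smul_apply, smul_eq_mul]
    rfl
  simp only [h3, mul_assoc]
  rw [integral_const_mul, h1, eq_inv_mul_iff_mul_eq₀ hκ, ← h2]
  congr 1
  ext z
  rw [mul_comm, analysis]
  congr 2
  ext y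
  rw [conj_atom, mul_comm]

lemma shift_conj (φ : SOmega ω d) (z : Space d × Space d) :
    φ.conj.shift z = (φ.shift (z.1, -z.2)).conj := by
  apply toSchwartz_injective
  ext y
  rw [conj_apply, toSchwartz_shift, toSchwartz_shift, conj_atom, neg_neg]
  rfl

lemma conj_ne_zero {φ : SOmega ω d} (hφ : φ ≠ 0) : φ.conj ≠ 0 := by
  intro h
  refine hφ (toSchwartz_injective (SchwartzMap.ext fun y => ?_))
  have := conj_apply φ y
  rw [h, map_zero] at this
  simpa using this.symm

end SOmega

/-! ### The wave front set -/

/-- Boundedness along all rays through a set of directions holds locally and passes to finite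
unions, hence holds for the compact unit sphere. The origin lies on no ray and is added separately.
-/
lemma bddAbove_stft_of_waveFrontSet_eq_empty {φ : SOmega ω d} {u : SOmegaDual ω d}
    (h : waveFrontSet φ u = ∅) {l : ℝ} (hl : 0 < l) :
    ∃ C : ℝ, ∀ z, Real.exp (l * ω.at z) * ‖stft φ u z‖ ≤ C := by
  set F : PhaseSpace d → ℝ := fun z => Real.exp (l * ω.at z) * ‖stft φ u z‖ with hF
  have hcompact : IsCompact (Metric.sphere (0 : PhaseSpace d) 1) := by
    have : ProperSpace (PhaseSpace d) := FiniteDimensional.proper ℝ _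
    exact isCompact_sphere _ _
  have key : ∃ C : ℝ, ∀ z ∈ Metric.sphere (0 : PhaseSpace d) 1, ∀ t : ℝ, 0 < t → F (t • z) ≤ C := by
    refine hcompact.induction_on (p := fun s => ∃ C : ℝ, ∀ z ∈ s, ∀ t : ℝ, 0 < t → F (t • z) ≤ C)
      ⟨0, by simp⟩ ?_ ?_ ?_
    · rintro s t hst ⟨C, hC⟩
      exact ⟨C, fun z hz => hC z (hst hz)⟩
    · rintro s t ⟨C, hC⟩ ⟨D, hD⟩
      refine ⟨max C D, fun z hz r hr => ?_⟩
      rcases hz with hz | hz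
      · exact (hC z hz r hr).trans (le_max_left _ _)
      · exact (hD z hz r hr).trans (le_max_right _ _)
    · intro z hz
      have hz0 : z ≠ 0 := by
        rintro rfl
        simp at hz
      have hnot : z ∉ waveFrontSet φ u := by simp [h]
      simp only [waveFrontSet, Set.mem_ofPred_eq, not_and, not_not] at hnot
      obtain ⟨Γ, hΓo, hΓc, -, hzΓ, hb⟩ := hnot hz0
      obtain ⟨C, hC⟩ := hb l hl
      exact ⟨Γ, mem_nhdsWithin_of_mem_nhds (hΓo.mem_nhds hzΓ), C, fun w hw t ht =>
        hC ⟨t • w, hΓc w hw t ht, rfl⟩⟩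
  obtain ⟨C, hC⟩ := key
  refine ⟨max C (F 0), fun z => ?_⟩
  by_cases hz : z = 0
  · rw [hz]
    exact le_max_right _ _
  · have hz' : 0 < ‖z‖ := norm_pos_iff.2 hz
    have h1 := hC (‖z‖⁻¹ • z) (by simp [norm_smul, hz'.ne']) ‖z‖ hz'
    rw [smul_inv_smul₀ hz'.ne'] at h1
    exact h1.trans (le_max_left _ _)

lemma waveFrontSet_eq_empty_of_isInSOmega (φ : SOmega ω d) {u : SOmegaDual ω d}
    (hu : u.IsInSOmega) : waveFrontSet φ u = ∅ := by
  obtain ⟨f, hf⟩ := hu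
  have hstft : ∀ z : PhaseSpace d,
      stft φ u z = analysis (SOmega.toSchwartz φ) (SOmega.toSchwartz f) (z.fst, z.snd) :=
    fun z => hf _
  ext z₀
  simp only [waveFrontSet, Set.mem_ofPred_eq, Set.mem_empty_iff_false, iff_false, not_and, not_not]
  intro hz₀
  refine ⟨{0}ᶜ, isOpen_compl_singleton, fun z hz t ht => smul_ne_zero ht.ne' hz, by simp, hz₀,
    fun l hl => ?_⟩
  obtain ⟨C, hC⟩ := SOmega.rapidDecay_analysis φ f l hl
  refine ⟨C, ?_⟩
  rintro _ ⟨z, -, rfl⟩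
  refine le_trans ?_ (hC (z.fst, z.snd))
  dsimp only
  rw [hstft]
  have := ω.at_toLp_le_pair (z.fst, z.snd)
  gcongr
  exact this

end UltraGabor

end

theorem mainTheorem2 (d : ℕ) (ω : UltraGabor.WeightFunction) (φ : UltraGabor.SOmega ω d)
    (hφ : φ ≠ 0) (u : UltraGabor.SOmegaDual ω d) :
    UltraGabor.waveFrontSet φ u = ∅ ↔ UltraGabor.SOmegaDual.IsInSOmega u := by
  refine ⟨fun h => ?_, UltraGabor.waveFrontSet_eq_empty_of_isInSOmega φ⟩
  -- With the conjugate window, `u(Π(x,ξ)φ̄)` is exactly `V_φ u(x,-ξ)`.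
  refine UltraGabor.SOmega.isInSOmega_of_rapidDecay (UltraGabor.SOmega.conj_ne_zero hφ)
    fun l hl => ?_
  -- The factor `2` compensates `ω(x) + ω(ξ) ≤ 2 ω(z)`.
  obtain ⟨C, hC⟩ := UltraGabor.bddAbove_stft_of_waveFrontSet_eq_empty h (l := 2 * l) (by positivity)
  refine ⟨C, fun z => le_trans ?_ (hC (WithLp.toLp 2 (z.1, -z.2)))⟩
  dsimp only
  rw [UltraGabor.SOmega.shift_conj]
  refine mul_le_mul_of_nonneg_right (Real.exp_le_exp.2 ?_) (norm_nonneg _)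
  have h1 := ω.pair_le_two_mul (z.1, -z.2)
  have h2 : ω.pair (z.1, -z.2) = ω.pair z := by
    simp only [UltraGabor.WeightFunction.pair, UltraGabor.WeightFunction.at_neg]
  rw [h2] at h1
  linarith [mul_le_mul_of_nonneg_left h1 hl.le]
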